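/- **Setting.** Let $V=[n]$, $k=\lceil n/\log^{1/2}n\rceil$. $\Omega_k$ is the set of digraphs $D$ on $V$ in which exactly $k$ vertices have out-degree 2 and all others have out-degree 3, the out-arcs of a vertex forming an ordered tuple chosen with replacement, loops allowed. Put $K(D)=\{v: d^+_D(v)=2\}$, $L(D)=\{v\in K(D): d^-_D(v)=0\}$, and let $\Gamma_D$ be the underlying multigraph. For $(D_1,A)\in\Omega_k\times[n]^k$ the $k$-tuple $A$ gives the head of a third out-arc for each vertex of $K(D_1)$; $A_2$ denotes those arcs with tail in $L=L(D_1)$, $A_3$ the others, and $K=K(D_1)$. **Procedure.** The Extension–Rotation Procedure starts with a simple 2-matching $F$ (a spanning collection of vertex-disjoint paths and cycles; isolated vertices are paths) of $G_2=\Gamma_{D_1+A_2}$; the current graph $E$ is initially $G_2$. Until $F$ is a single cycle it repeats the following. If $F$ has no path, it uses an edge of $E$ between two cycles to merge them into a path. Otherwise let $P$ be a longest path of $F$, $X$ its vertex set, $\mathrm{END}$ the set of end-points of paths of $E$ spanning $X$, and $\mathrm{END}(x)$ the set of end-points other than $x$ of such paths having $x$ as one end. If some $x\in\mathrm{END}$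 has a neighbour $y$ in a cycle of $F$, then $P$ and that cycle are replaced by one path (a path on $X$ ending in $x$, then $xy$, then the cycle cut at $y$). If some $x\in\mathrm{END}$ has a neighbour $y$ in another path $Q$ of $F$, a path on $X$ ending in $x$ is extended via $xy$ along $Q$ to one of its end-points, the rest of $Q$ remaining as a path. If all neighbours of $\mathrm{END}$ lie in $X$, the vertices of $\mathrm{END}$ are put in a (random) order and checked one at a time: for $x$ it is revealed whether $x\in K\setminus L$, and if so the arc $(x,y_x)\in A_3$ is revealed; if $y_x\in \mathrm{END}(x)$ then a path spanning $X$ from $x$ to $y_x$ is closed to a cycle replacing $P$, the edge $\{x,y_x\}$ is added to $E$, and the next iteration begins; otherwise the next element of $\mathrm{END}$ is checked; if none is left the procedure fails. All free choices, including the initial 2-matching and the random orders, are resolved by an arbitrary rule that sees only $\Gamma_{D_1}$, $A_2$ and what has been revealed so far. **Partitions.** For a given rule and $i\ge 0$, two elements of $\Omega_k\times[n]^k$ are in the same part of the $i$-th partition if they have the same $\Gamma_{D_1}$, the same $A_2$, and the same first $i$ checks with the same outcomes. For a part $\mathcal X$, let $\mathcal D_1(\mathcal X)=\{D_1:\exists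 A,\ (D_1,A)\in\mathcal X\}$, let $C_{\mathcal X}$ be the set of vertices among the first $i$ checked, $I_{\mathcal X}=C_{\mathcal X}\cap(K\setminus L)$, $O_{\mathcal X}=L\cup(C_{\mathcal X}\setminus K)$, and let $\Gamma_{\mathcal X}$ be $\Gamma_{D_1+A_2}$ together with the edges of $A_3$ added during these checks. **$\mathcal E_G$.** A multigraph $G$ on $[n]$ is in $\mathcal E_G$ if one of the following holds. (a) $\Delta(G)\ge 2\log n/\log\log n$. (b) There are a vertex set $S$ and an integer $1\le i\le 10$ with $|S|<\frac i4\log n$ such that $G[S]$ is connected and has at least $|S|+i$ edges. (c) There are vertex sets $S_1,S_2,T_1,T_2$ such that: $S_1\cap S_2=\emptyset$ and $n^{1/30}\le|S_1|+|S_2|\le n/100$; for each $x\in S_1$ there is $y_x\in S_1\cup T_1$ with $\{x,y_x\}$ an edge, where $u,x\in S_1$, $u=y_x$ imply $x\ne y_u$; for each $x\in S_2$ there are distinct $y_x,z_x\in T_2$ with $\{x,y_x\},\{x,z_x\}$ edges; $T_1=\{y_x:x\in S_1,\ y_x\notin S_1\}$ and $T_2=\{y_x,z_x:x\in S_2\}$;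 $N(S_1),N(S_2)\subseteq T_1\cup T_2$, where $N(S)$ is the set of vertices outside $S$ with a neighbour in $S$; and $S_2$ is independent. **$\mathcal E_D$.** Let $\tau=3-\log^{-1/2}n$, $\ell=\lceil10\log_\tau\log n\rceil$, $\pi_{\rm in}=1000(\log\log n)\log^{10}n$, $\pi_{\rm out}=\frac{\log^{10}n}{(\log\log n)^2}\cdot\frac kn$, $\rho_{\rm in}=\log^{20}n$. For $D\in\Omega_k$ let $\Pi_{D,x\leftarrow V}$ be the set of $y\in V$ from which a shortest directed path to $x$ has length $\ell$, and $\Pi_{D,x\to K}$ the set of $z\in K(D)$ to which a shortest directed path from $x$ has length $\ell$. Then $D\in\mathcal E_D$ if $|\{x:|\Pi_{D,x\to K}|\le\pi_{\rm out}\}|\ge n/\log^{100}n$, or $|\{x:|\Pi_{D,x\leftarrow V}|\ge\pi_{\rm in}\}|\ge10n/\log^{100}n$, or $|\Pi_{D,x\leftarrow V}|\ge\rho_{\rm in}$ for some $x$. **Lemma.** Suppose that $\mathcal X$ is a part of one of these partitions such that $\Gamma_{\mathcal X}\notin\mathcal E_G$ and $$|\mathcal E_D\cap\mathcal D_1(\mathcal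 X)|<n^2e^{-\log^2n}\,|\mathcal D_1(\mathcal X)|,$$ and suppose further that $|I_{\mathcal X}|\le\frac{1200n}{\log n}$ and $|O_{\mathcal X}|=o(n)$. If $D$ is chosen uniformly at random from $\mathcal D_1(\mathcal X)$ then $$\left|\left\{x\in V:\Pr(x\in K(D))\le\frac kn\cdot\frac1{4000(\log\log n)^3}\right\}\right|=o(n).$$ Here the asymptotics are uniform: for every function $f(n)=o(n)$ there is a function $g(n)=o(n)$ such that, for all $n$, all rules, all $i$ and all such parts $\mathcal X$ with $|O_{\mathcal X}|\le f(n)$, the set above has at most $g(n)$ elements. -/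

import Mathlib

open Filter Asymptotics

namespace ThreeOut

/-! ### Multigraphs on `Fin n` -/

/-- A finite multigraph on the vertex set `Fin n` (parallel edges and loops allowed), given by its
multiset of edges. -/
abbrev MGraph (n : ℕ) := Multiset (Sym2 (Fin n))

namespace MGraph

def Adj {n : ℕ} (G : MGraph n) (u v : Fin n) : Prop := s(u, v) ∈ G

/-- Degree of a vertex; a loop counts twice. -/
def degree {n : ℕ} (G : MGraph n) (v : Fin n) : ℕ :=
  Multiset.countP (fun e => v ∈ e) G + Multiset.count s(v, v) G

/-- The underlying simple graph. It is used for connectivity only. -/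
def toSimple {n : ℕ} (G : MGraph n) : SimpleGraph (Fin n) :=
  SimpleGraph.fromEdgeSet {e | e ∈ G}

open Classical in
/-- The number of edges, with multiplicity, with both ends in `S`. -/
noncomputable def spanned {n : ℕ} (G : MGraph n) (S : Finset (Fin n)) : ℕ :=
  Multiset.countP (fun e => ∀ v ∈ e, v ∈ S) G

/-- `N(S)`: the vertices outside `S` with a neighbour in `S`. -/
def nbhd {n : ℕ} (G : MGraph n) (S : Finset (Fin n)) : Set (Fin n) :=
  {y | y ∉ S ∧ ∃ x ∈ S, G.Adj x y}

end MGraph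

/-! ### The collection `E_G` of graphs -/

noncomputable def Delta0 (n : ℕ) : ℝ := 2 * Real.log n / Real.log (Real.log n)

/-- There is a vertex of degree at least `Δ₀`. -/
def ELarge (n : ℕ) : Set (MGraph n) := {G | ∃ v : Fin n, Delta0 n ≤ (G.degree v : ℝ)}

/-- There are a set `S` and `1 ≤ i ≤ 10` with `|S| < (i/4) log n` such that the graph induced by `S`
is connected and has at least `|S| + i` edges. -/
def ESmall (n : ℕ) : Set (MGraph n) :=
  {G | ∃ (S : Finset (Fin n)) (i : ℕ), 1 ≤ i ∧ i ≤ 10 ∧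
    (S.card : ℝ) < (i : ℝ) / 4 * Real.log n ∧
    (G.toSimple.induce (S : Set (Fin n))).Connected ∧ S.card + i ≤ G.spanned S}

def EPieces (n : ℕ) : Set (MGraph n) :=
  {G | ∃ (S₁ S₂ T₁ T₂ : Finset (Fin n)) (y z : Fin n → Fin n),
    (Disjoint S₁ S₂ ∧ (n : ℝ) ^ ((1 : ℝ) / 30) ≤ (S₁.card : ℝ) + (S₂.card : ℝ) ∧
      (S₁.card : ℝ) + (S₂.card : ℝ) ≤ (n : ℝ) / 100) ∧
    ((∀ x ∈ S₁, (y x ∈ S₁ ∨ y x ∈ T₁) ∧ G.Adj x (y x)) ∧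
      ∀ u ∈ S₁, ∀ x ∈ S₁, u = y x → x ≠ y u) ∧
    (∀ x ∈ S₂, y x ∈ T₂ ∧ z x ∈ T₂ ∧ y x ≠ z x ∧ G.Adj x (y x) ∧ G.Adj x (z x)) ∧
    (T₁ = (S₁.image y).filter (fun w => w ∉ S₁) ∧ T₂ = S₂.image y ∪ S₂.image z) ∧
    (∀ w, w ∈ G.nbhd S₁ ∪ G.nbhd S₂ → w ∈ T₁ ∪ T₂) ∧
    (∀ u ∈ S₂, ∀ v ∈ S₂, ¬ G.Adj u v)}

def EG (n : ℕ) : Set (MGraph n) := ELarge n ∪ ESmall n ∪ EPieces n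

/-! ### Digraphs with out-degrees two and three -/

/-- A digraph on `Fin n` in which each vertex has an ordered tuple of two or of three out-arcs,
chosen with replacement and with loops allowed; the arcs are given by their heads. -/
abbrev OutDigraph (n : ℕ) := Fin n → (Fin 2 → Fin n) ⊕ (Fin 3 → Fin n)

/-- The multiset of heads of the out-arcs of `v`. -/
def heads {n : ℕ} (D : OutDigraph n) (v : Fin n) : Multiset (Fin n) :=
  Sum.elim (fun f => Finset.univ.val.map f) (fun f => Finset.univ.val.map f) (D v)

/-- The vertices of out-degree two. -/
def K {n : ℕ} (D : OutDigraph n) : Finset (Fin n) := Finset.univ.filter (fun v => (D v).isLeft)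

def inDegree {n : ℕ} (D : OutDigraph n) (v : Fin n) : ℕ := ∑ u, (heads D u).count v

/-- The vertices of out-degree two and in-degree zero. -/
def L {n : ℕ} (D : OutDigraph n) : Finset (Fin n) := (K D).filter (fun v => inDegree D v = 0)

/-- The underlying multigraph `Γ_D`. -/
def underlying {n : ℕ} (D : OutDigraph n) : MGraph n :=
  ∑ v, (heads D v).map (fun w => s(v, w))

/-- There is a directed walk of length `m` from `u` to `v`. -/
def HasWalk {n : ℕ} (D : OutDigraph n) : ℕ → Fin n → Fin n → Prop
  | 0, u, v => u = v
  | m + 1, u, v => ∃ w ∈ heads D u, HasWalk D m w v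

/-- There is a shortest directed path from `u` to `v`, and it has length `m`. -/
def IsDist {n : ℕ} (D : OutDigraph n) (m : ℕ) (u v : Fin n) : Prop :=
  HasWalk D m u v ∧ ∀ j < m, ¬ HasWalk D j u v

/-- `k = ⌈n / log^{1/2} n⌉`. -/
noncomputable def k (n : ℕ) : ℕ := ⌈(n : ℝ) / √(Real.log n)⌉₊

/-- `Ω_k`: exactly `k` vertices have out-degree two, the others have out-degree three. -/
abbrev Omega (n : ℕ) := {D : OutDigraph n // (K D).card = k n}

/-! ### The collection `E_D` of digraphs -/

noncomputable def tau (n : ℕ) : ℝ := 3 - 1 / √(Real.log n)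

noncomputable def ell (n : ℕ) : ℕ := ⌈10 * Real.logb (tau n) (Real.log n)⌉₊

noncomputable def piIn (n : ℕ) : ℝ := 1000 * Real.log (Real.log n) * Real.log n ^ 10

noncomputable def piOut (n : ℕ) : ℝ :=
  Real.log n ^ 10 / Real.log (Real.log n) ^ 2 * ((k n : ℝ) / n)

noncomputable def rhoIn (n : ℕ) : ℝ := Real.log n ^ 20

/-- `Π_{D, x ← V}`. -/
def PiFromV {n : ℕ} (D : OutDigraph n) (x : Fin n) : Set (Fin n) :=
  {y | IsDist D (ell n) y x}

/-- `Π_{D, x → K}`. -/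
def PiToK {n : ℕ} (D : OutDigraph n) (x : Fin n) : Set (Fin n) :=
  {z | z ∈ K D ∧ IsDist D (ell n) x z}

def PsiFromV (n : ℕ) : Set (Omega n) :=
  {D | 10 * (n : ℝ) / Real.log n ^ 100 ≤
        ({x | piIn n ≤ ((PiFromV D.1 x).ncard : ℝ)} : Set (Fin n)).ncard ∨
      ∃ x, rhoIn n ≤ ((PiFromV D.1 x).ncard : ℝ)}

def PsiToK (n : ℕ) : Set (Omega n) :=
  {D | (n : ℝ) / Real.log n ^ 100 ≤
        ({x | ((PiToK D.1 x).ncard : ℝ) ≤ piOut n} : Set (Fin n)).ncard}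

def ED (n : ℕ) : Set (Omega n) := PsiToK n ∪ PsiFromV n

/-! ### The sample space `Ω_k × [n]^k` -/

abbrev Sample (n : ℕ) := Omega n × (Fin (k n) → Fin n)

/-- The head of the third (set-aside) out-arc of a vertex of `K`: the entries of the `k`-tuple are
assigned to the vertices of `K` in increasing order. -/
noncomputable def third {n : ℕ} (ω : Sample n) (v : Fin n) : Option (Fin n) :=
  if h : v ∈ K ω.1.1 then some (ω.2 (((K ω.1.1).orderIsoOfFin ω.1.2).symm ⟨v, h⟩)) else none

/-- The arcs `A₂`, as a partial function from tails to heads: the third arcs of the vertices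
in `L`. -/
noncomputable def A2 {n : ℕ} (ω : Sample n) (v : Fin n) : Option (Fin n) :=
  if v ∈ L ω.1.1 then third ω v else none

/-- The arcs `A₃`: the third arcs of the vertices in `K \ L`. So `A3 ω v = none` exactly when
`v ∉ K \ L`. -/
noncomputable def A3 {n : ℕ} (ω : Sample n) (v : Fin n) : Option (Fin n) :=
  if v ∈ K ω.1.1 \ L ω.1.1 then third ω v else none

/-- The edges of those arcs of `a` that have their tail in `B`. -/
def arcEdges {n : ℕ} (a : Fin n → Option (Fin n)) (B : Finset (Fin n)) : MGraph n :=
  ∑ v ∈ B, (a v).elim 0 (fun w => {s(v, w)})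

/-- The underlying graph of `D₁ + A₂` together with the arcs of `A₃` with tail in `B`. -/
noncomputable def graph {n : ℕ} (ω : Sample n) (B : Finset (Fin n)) : MGraph n :=
  underlying ω.1.1 + arcEdges (A2 ω) Finset.univ + arcEdges (A3 ω) B

/-! ### Simple 2-matchings, as collections of paths and cycles -/

/-- A collection of paths and cycles; each is given by the list of its vertices in order.
An isolated vertex is a path with one vertex. -/
structure Cover (n : ℕ) where
  paths : Finset (List (Fin n))
  cycles : Finset (List (Fin n))

def pathEdges {n : ℕ} : List (Fin n) → MGraph n
  | [] => 0
  | [_] => 0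
  | a :: b :: l => s(a, b) ::ₘ pathEdges (b :: l)

def cycleEdges {n : ℕ} : List (Fin n) → MGraph n
  | [] => 0
  | a :: l => s((a :: l).getLast (List.cons_ne_nil a l), a) ::ₘ pathEdges (a :: l)

/-- `F` is a simple 2-matching of `G`: its components are nonempty, partition the vertex set, and
form a subgraph of the multigraph `G`. -/
def IsTwoMatching {n : ℕ} (G : MGraph n) (F : Cover n) : Prop :=
  [] ∉ F.paths ∧ [] ∉ F.cycles ∧
  (∀ v, ∑ p ∈ F.paths, p.count v + ∑ c ∈ F.cycles, c.count v = 1) ∧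
  ∑ p ∈ F.paths, pathEdges p + ∑ c ∈ F.cycles, cycleEdges c ≤ G

/-- `P` is a longest path of `F`. -/
def Cover.IsLongest {n : ℕ} (F : Cover n) (P : List (Fin n)) : Prop :=
  P ∈ F.paths ∧ ∀ Q ∈ F.paths, Q.length ≤ P.length

/-- `q` is a path of `G` that spans the vertex set `X`. -/
def IsPathOn {n : ℕ} (G : MGraph n) (X : Finset (Fin n)) (q : List (Fin n)) : Prop :=
  q.Nodup ∧ q.toFinset = X ∧ q.IsChain G.Adj

/-- `END`: the end-points of the paths that span `X`. -/
def END {n : ℕ} (G : MGraph n) (X : Finset (Fin n)) : Set (Fin n) :=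
  {x | ∃ q, IsPathOn G X q ∧ q.getLast? = some x}

/-- `END(x)`: the end-points, other than `x`, of the paths that span `X` and have `x` as one
end-point. -/
def ENDFrom {n : ℕ} (G : MGraph n) (X : Finset (Fin n)) (x : Fin n) : Set (Fin n) :=
  {y | y ≠ x ∧ ∃ q, IsPathOn G X q ∧ q.head? = some x ∧ q.getLast? = some y}

/-- The path `p` results from the cycle `c` by deleting one of its edges. -/
def Opens {n : ℕ} (c p : List (Fin n)) : Prop := p ~r c ∨ p ~r c.reverse

/-! ### The Extension-Rotation Procedure -/

/-- State of the procedure: the current 2-matching, the tails of the arcs of `A₃` whose edges have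
been added to the graph, the list of all checks made so far with their outcomes (`none` when the
vertex is not in `K \ L`, and otherwise the head of its third arc), and, while the end-points of the
paths spanning a longest path `P` are being checked, `P` with the list of those that remain. -/
structure State (n : ℕ) where
  F : Cover n
  added : Finset (Fin n)
  checks : List (Fin n × Option (Fin n))
  pending : Option (List (Fin n) × List (Fin n))

/-- One step of the procedure on the input `ω`. No step is possible when the 2-matching is a single
cycle, when the pending list is exhausted (failure), or when there are several cycles, no paths, and
no edge between different cycles (which requires that the graph is disconnected). -/
inductive Step {n : ℕ} (ω : Sample n) : State n → State n → Prop
  /-- There are no paths: an edge `{x, y}` between two cycles merges them into one path. -/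
  | mergeCycles (s : State n) (c c' p p' : List (Fin n)) (x y : Fin n)
      (hs : s.pending = none) (hF : s.F.paths = ∅)
      (hc : c ∈ s.F.cycles) (hc' : c' ∈ s.F.cycles) (hne : c ≠ c')
      (hp : Opens c p) (hp' : Opens c' p')
      (hx : p.getLast? = some x) (hy : p'.head? = some y)
      (hxy : (graph ω s.added).Adj x y) :
      Step ω s { s with F := ⟨{p ++ p'}, (s.F.cycles.erase c).erase c'⟩ }
  /-- A path `q` on the vertex set of `P` that ends in `x` absorbs the cycle containing a
  neighbour `y` of `x`. -/
  | absorbCycle (s : State n) (P q c p : List (Fin n)) (x y : Fin n)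
      (hs : s.pending = none) (hP : s.F.IsLongest P)
      (hq : IsPathOn (graph ω s.added) P.toFinset q) (hx : q.getLast? = some x)
      (hc : c ∈ s.F.cycles) (hp : Opens c p) (hy : p.head? = some y)
      (hxy : (graph ω s.added).Adj x y) :
      Step ω s { s with F := ⟨insert (q ++ p) (s.F.paths.erase P), s.F.cycles.erase c⟩ }
  /-- A path `q` on the vertex set of `P` that ends in `x` is extended, through a neighbour `y` of
  `x` in another path `Q`, along `Q` to one of the end-points of `Q`. -/
  | absorbPath (s : State n) (P q Q l r : List (Fin n)) (x y : Fin n)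
      (hs : s.pending = none) (hP : s.F.IsLongest P)
      (hq : IsPathOn (graph ω s.added) P.toFinset q) (hx : q.getLast? = some x)
      (hQ : Q ∈ s.F.paths) (hne : Q ≠ P)
      (hl : Q = l ++ y :: r ∨ Q.reverse = l ++ y :: r)
      (hxy : (graph ω s.added).Adj x y) :
      Step ω s { s with
        F := ⟨insert (q ++ y :: r) ((s.F.paths.erase P).erase Q) ∪ (if l = [] then ∅ else {l}),
          s.F.cycles⟩ }
  /-- All neighbours of the vertices of `END` are on `P`: put `END` in some order. -/
  | order (s : State n) (P o : List (Fin n))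
      (hs : s.pending = none) (hP : s.F.IsLongest P)
      (hN : ∀ x ∈ END (graph ω s.added) P.toFinset, ∀ y, (graph ω s.added).Adj x y → y ∈ P)
      (ho : o.Nodup) (hmem : ∀ x, x ∈ o ↔ x ∈ END (graph ω s.added) P.toFinset) :
      Step ω s { s with pending := some (P, o) }
  /-- Check `x`: it is not in `K \ L`, or its third arc does not end in `END(x)`. -/
  | checkMiss (s : State n) (P o : List (Fin n)) (x : Fin n)
      (hs : s.pending = some (P, x :: o))
      (hx : ∀ y, A3 ω x = some y → y ∉ ENDFrom (graph ω s.added) P.toFinset x) :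
      Step ω s { s with checks := s.checks ++ [(x, A3 ω x)], pending := some (P, o) }
  /-- Check `x`: it is in `K \ L` and its third arc ends in `y ∈ END(x)`. A path spanning the vertex
  set of `P` from `x` to `y` is closed to a cycle and the edge `{x, y}` is added. -/
  | checkHit (s : State n) (P o q : List (Fin n)) (x y : Fin n)
      (hs : s.pending = some (P, x :: o)) (hx : A3 ω x = some y)
      (hy : y ∈ ENDFrom (graph ω s.added) P.toFinset x)
      (hq : IsPathOn (graph ω s.added) P.toFinset q)
      (hqx : q.head? = some x) (hqy : q.getLast? = some y) :
      Step ω s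
        { F := ⟨s.F.paths.erase P, insert q s.F.cycles⟩
          added := insert x s.added
          checks := s.checks ++ [(x, some y)]
          pending := none }

/-- A resolution of all choices that the procedure leaves open (the initial 2-matching, the paths
and edges that are used, and the outcome of the random orderings of the sets `END`). It sees only
what has been revealed: `Γ_{D₁}`, the arcs `A₂`, the current state with the outcomes of all checks
so far, and the set of the states that may come next. That set depends on the unrevealed part of the
input only in a check, and there only through the outcome of the check. -/
structure Rule (n : ℕ) where
  start : MGraph n → (Fin n → Option (Fin n)) → Cover n
  start_spec : ∀ ω : Sample n, IsTwoMatching (graph ω ∅) (start (underlying ω.1.1) (A2 ω))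
  next : MGraph n → (Fin n → Option (Fin n)) → State n → Set (State n) → State n
  next_spec : ∀ G a s (S : Set (State n)), S.Nonempty → next G a s S ∈ S

namespace Rule

open Classical in
/-- The state after `t` steps; the procedure stays where it is when no step is possible. -/
noncomputable def run {n : ℕ} (R : Rule n) (ω : Sample n) : ℕ → State n
  | 0 => ⟨R.start (underlying ω.1.1) (A2 ω), ∅, [], none⟩
  | t + 1 =>
    if {s | Step ω (R.run ω t) s}.Nonempty then
      R.next (underlying ω.1.1) (A2 ω) (R.run ω t) {s | Step ω (R.run ω t) s}
    else R.run ω t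

/-- The partition of the sample space after `i` checks: two samples are in the same part when they
have the same graph `Γ_{D₁}`, the same arcs `A₂` (and hence the same set `L`), and the procedure has
the same first `i` checks with the same outcomes on both. -/
def filtration {n : ℕ} (R : Rule n) (i : ℕ) : Setoid (Sample n) where
  r ω ω' := underlying ω.1.1 = underlying ω'.1.1 ∧ A2 ω = A2 ω' ∧
    ∀ t, (R.run ω t).checks.take i = (R.run ω' t).checks.take i
  iseqv :=
    ⟨fun _ => ⟨rfl, rfl, fun _ => rfl⟩,
     fun h => ⟨h.1.symm, h.2.1.symm, fun t => (h.2.2 t).symm⟩,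
     fun h h' => ⟨h.1.trans h'.1, h.2.1.trans h'.2.1, fun t => (h.2.2 t).trans (h'.2.2 t)⟩⟩

/-- `C`: the vertices among the first `i` checked. -/
def checked {n : ℕ} (R : Rule n) (i : ℕ) (ω : Sample n) : Set (Fin n) :=
  {v | ∃ t a, (v, a) ∈ (R.run ω t).checks.take i}

/-- `I`: the checked vertices that are in `K \ L`. -/
def inSet {n : ℕ} (R : Rule n) (i : ℕ) (ω : Sample n) : Set (Fin n) :=
  {v | v ∈ R.checked i ω ∧ v ∈ K ω.1.1 \ L ω.1.1}

/-- `O`: the vertices of `L` and the checked vertices that are not in `K`. -/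
def outSet {n : ℕ} (R : Rule n) (i : ℕ) (ω : Sample n) : Set (Fin n) :=
  {v | v ∈ L ω.1.1 ∨ (v ∈ R.checked i ω ∧ v ∉ K ω.1.1)}

open Classical in
/-- `Γ_{D₁ + A₂}` together with the edges that the procedure has added in its first `i` checks. -/
noncomputable def currentGraph {n : ℕ} (R : Rule n) (i : ℕ) (ω : Sample n) : MGraph n :=
  graph ω (Finset.univ.filter
    (fun v => ∃ t, (R.run ω t).checks.length ≤ i ∧ v ∈ (R.run ω t).added))

end Rule

/-- `D₁(X)`: the digraphs that occur in the part `X`. -/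
def D1 {n : ℕ} (X : Set (Sample n)) : Set (Omega n) := {D | ∃ A, (D, A) ∈ X}

/-- The probability that `x ∈ K(D)` when `D` is uniform in `D₁(X)`. -/
noncomputable def probK {n : ℕ} (X : Set (Sample n)) (x : Fin n) : ℝ :=
  (({D | D ∈ D1 X ∧ x ∈ K D.1} : Set (Omega n)).ncard : ℝ) / ((D1 X).ncard : ℝ)

end ThreeOut

/-! The proof is a switching argument inside `D1 X`. Take an unchecked vertex x with no short cycle
nearby, a digraph D of `D1 X` in which x has out-degree 3, and a vertex z of K(D) \ I at distance
exactly ℓ from x. Reversing a shortest path from x to z moves one unit of out-degree from x to z: x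
enters K and z leaves it, while Γ_D, L and the status of every checked vertex stay the same. These
data decide membership in `D1 X` (`filtration_of_agree`, `mem_D1_of_agree`), so the new digraph is
again in `D1 X`. Conversely, a walk of length at most ℓ that ends in x is determined by its start
(`walk_unique`), so D is recovered from the new digraph, z and the index in {0, 1, 2} of the out-arc
that x lost. Double counting (`sum_PiToK_le`) gives Σ_{D : x ∉ K} |Π_{D,x→K} \ I| ≤ 3 Σ_{D : x ∈ K}
|Π_{D,x←V}|.

If on average over D the set Π_{D,x→K} has more than π_out elements, few of them in I, and Π_{D,x←V}
has fewer than π_in, then this forces Pr(x ∈ K) > π_out / (4 π_in), which is exactly the stated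
threshold (`lt_frequency_of_switching`, `threshold_eq`). A digraph outside E_D behaves in this way
at most x; for the intersection with I, count pairs (x, z) with z ∈ I through the in-neighbourhoods
of z and use that |I| π_in / n is of smaller order than π_out. Digraphs in E_D are so rare that even
a weight n² for each of them is harmless. Markov's inequality then leaves at most n / log log n bad
vertices x for each of the three requirements.

It remains to bound the number of vertices near short cycles (`card_cyclic_mul_le`). Outside E_G, a
small connected set spans at most one cycle. Hence the out-balls around disjoint short cycles are
disjoint, and they grow like powers of 2 because out-degrees are at least 2; there are therefore few
disjoint short cycles, and by the degree bound few vertices near them. Finally, a checked vertex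
outside O belongs to K with probability 1. -/

namespace ThreeOut

variable {n : ℕ}

/-! ### Edge counts, adjacency and directed walks. -/

theorem countP_mem_eq_sum_count (m : Multiset (Fin n)) (S : Finset (Fin n)) :
    m.countP (fun w => w ∈ S) = ∑ v ∈ S, m.count v := by
  induction m using Multiset.induction_on with
  | empty => simp
  | cons a m ih =>
    rw [Multiset.countP_cons, ih]
    simp only [Multiset.count_cons, Finset.sum_add_distrib]
    congr 1
    rw [Finset.sum_ite_eq' S a (fun _ => 1)]

/-- The number of edges of `Γ_D` spanned by `S`, counted by tails and heads. -/
theorem spanned_underlying (D : OutDigraph n) (S : Finset (Fin n)) :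
    (underlying D).spanned S = ∑ u ∈ S, ∑ v ∈ S, (heads D u).count v := by
  classical
  have h : ∀ u, Multiset.countP (fun e : Sym2 (Fin n) => ∀ v ∈ e, v ∈ S)
      ((heads D u).map (fun w => s(u, w))) =
      if u ∈ S then ∑ v ∈ S, (heads D u).count v else 0 := by
    intro u
    rw [Multiset.countP_map, ← Multiset.countP_eq_card_filter]
    by_cases hu : u ∈ S
    · rw [if_pos hu, ← countP_mem_eq_sum_count]
      exact Multiset.countP_congr rfl (fun w _ => by simp [hu])
    · rw [if_neg hu, Multiset.countP_eq_zero]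
      intro w _ hw
      exact hu (hw u (by simp))
  unfold MGraph.spanned underlying
  have := map_sum (Multiset.countPAddMonoidHom (fun e : Sym2 (Fin n) => ∀ v ∈ e, v ∈ S))
    (fun u => (heads D u).map (fun w => s(u, w))) Finset.univ
  simp only [Multiset.coe_countPAddMonoidHom] at this
  rw [Finset.sum_congr rfl (fun u _ => h u)] at this
  rw [Finset.sum_ite_mem, Finset.univ_inter] at this
  convert this

theorem adj_underlying_of_mem {D : OutDigraph n} {u v : Fin n} (h : v ∈ heads D u) :
    (underlying D).Adj u v := by
  unfold MGraph.Adj underlying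
  rw [Multiset.mem_sum]
  exact ⟨u, Finset.mem_univ _, Multiset.mem_map_of_mem _ h⟩

theorem MGraph.Adj.symm {G : MGraph n} {u v : Fin n} (h : G.Adj u v) : G.Adj v u := by
  unfold MGraph.Adj at *
  rwa [Sym2.eq_swap]

theorem MGraph.Adj.reachable {G : MGraph n} {S : Set (Fin n)} {u v : Fin n} (h : G.Adj u v)
    (hu : u ∈ S) (hv : v ∈ S) :
    (G.toSimple.induce S).Reachable ⟨u, hu⟩ ⟨v, hv⟩ := by
  by_cases huv : u = v
  · subst huv; rfl
  · apply SimpleGraph.Adj.reachable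
    simp only [SimpleGraph.comap_adj, Function.Embedding.subtype_apply, MGraph.toSimple,
      SimpleGraph.fromEdgeSet_adj]
    exact ⟨h, huv⟩

/-- A sequence of vertices that follows the arcs of `D` for the first `m` steps. -/
def Follows (D : OutDigraph n) (m : ℕ) (p : ℕ → Fin n) : Prop :=
  ∀ i < m, p (i + 1) ∈ heads D (p i)

theorem hasWalk_iff {D : OutDigraph n} {m : ℕ} {u v : Fin n} :
    HasWalk D m u v ↔ ∃ p : ℕ → Fin n, p 0 = u ∧ p m = v ∧ Follows D m p := by
  induction m generalizing u with
  | zero =>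
    constructor
    · rintro rfl
      exact ⟨fun _ => u, rfl, rfl, fun i hi => absurd hi (Nat.not_lt_zero i)⟩
    · rintro ⟨p, rfl, rfl, -⟩
      rfl
  | succ m ih =>
    constructor
    · rintro ⟨w, hw, h⟩
      obtain ⟨p, hp0, hpm, hp⟩ := ih.1 h
      refine ⟨fun i => Nat.casesOn i u p, rfl, hpm, ?_⟩
      rintro (_ | i) hi
      · simpa [hp0] using hw
      · exact hp i (by omega)
    · rintro ⟨p, rfl, hpm, hp⟩
      refine ⟨p 1, hp 0 (by omega), ih.2 ⟨fun i => p (i + 1), rfl, hpm, ?_⟩⟩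
      intro i hi
      exact hp (i + 1) (by omega)

theorem Follows.hasWalk {D : OutDigraph n} {m : ℕ} {p : ℕ → Fin n} (h : Follows D m p) {i j : ℕ}
    (hij : i ≤ j) (hj : j ≤ m) : HasWalk D (j - i) (p i) (p j) := by
  refine hasWalk_iff.2 ⟨fun t => p (i + t), rfl, ?_, ?_⟩
  · simp only; congr 1; omega
  · intro t ht
    exact h (i + t) (by omega)

theorem HasWalk.append {D : OutDigraph n} {a b : ℕ} {u v w : Fin n} (h : HasWalk D a u v)
    (h' : HasWalk D b v w) : HasWalk D (a + b) u w := by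
  induction a generalizing u with
  | zero => cases h; simpa using h'
  | succ a ih =>
    obtain ⟨y, hy, h⟩ := h
    rw [Nat.succ_add_eq_add_succ]
    exact ⟨y, hy, ih h⟩

/-- Cutting out the loop at a repeated vertex would give a shorter walk. -/
theorem Follows.injOn_of_isDist {D : OutDigraph n} {m : ℕ} {p : ℕ → Fin n} (h : Follows D m p)
    (hd : IsDist D m (p 0) (p m)) : Set.InjOn p (Set.Iic m) := by
  have key : ∀ i j, i < j → j ≤ m → p i ≠ p j := by
    intro i j hij hj he
    have h1 := h.hasWalk (Nat.zero_le i) (by omega)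
    have h2 := h.hasWalk hj le_rfl
    rw [he] at h1
    exact hd.2 _ (by omega) (h1.append h2)
  intro i hi j hj he
  rcases lt_trichotomy i j with hlt | heq | hlt
  · exact absurd he (key i j hlt hj)
  · exact heq
  · exact absurd he.symm (key j i hlt hi)

theorem Follows.connected {D : OutDigraph n} {m : ℕ} {p : ℕ → Fin n} (h : Follows D m p)
    {S : Set (Fin n)} (hS : ∀ i ≤ m, p i ∈ S) {i : ℕ} (hi : i ≤ m) :
    ((underlying D).toSimple.induce S).Reachable ⟨p 0, hS 0 (Nat.zero_le m)⟩ ⟨p i, hS i hi⟩ := by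
  induction i with
  | zero => rfl
  | succ i ih =>
    exact (ih (by omega)).trans
      ((adj_underlying_of_mem (h i (by omega))).reachable (hS i (by omega)) (hS (i + 1) hi))

/-! ### Uniqueness of walks away from short cycles. -/

/-- `x` lies in a connected set of at most `r` vertices that spans a cycle. -/
def Cyclic (G : MGraph n) (r : ℕ) (x : Fin n) : Prop :=
  ∃ S : Finset (Fin n), x ∈ S ∧ S.card ≤ r ∧
    (G.toSimple.induce (S : Set (Fin n))).Connected ∧ S.card ≤ G.spanned S

/-- The vertices other than `y` already account for |S| - 1 spanned arcs, one each, and no more than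
|S| - 1 are allowed. So there is equality throughout: `y` sends no arc into `S`, and every other
vertex sends exactly one. -/
theorem heads_of_spanned_lt {D : OutDigraph n} {S : Finset (Fin n)} {y : Fin n}
    (hS : (underlying D).spanned S < S.card) (hy : y ∈ S)
    (h : ∀ v ∈ S, v ≠ y → ∃ w ∈ S, w ∈ heads D v) :
    (∀ w ∈ S, w ∉ heads D y) ∧
      ∀ v ∈ S, ∀ w ∈ S, w ∈ heads D v → ∀ w' ∈ S, (heads D v).count w' = if w' = w then 1 else 0 := by
  classical
  have h1 : ∀ v ∈ S.erase y, 1 ≤ ∑ w ∈ S, (heads D v).count w := by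
    intro v hv
    obtain ⟨w, hw, hwv⟩ := h v (Finset.mem_of_mem_erase hv) (Finset.ne_of_mem_erase hv)
    exact (Multiset.one_le_count_iff_mem.2 hwv).trans
      (Finset.single_le_sum (f := fun w => (heads D v).count w) (fun _ _ => Nat.zero_le _) hw)
  have h2 : (∑ w ∈ S, (heads D y).count w) + ∑ v ∈ S.erase y, ∑ w ∈ S, (heads D v).count w
      ≤ (S.erase y).card := by
    rw [Finset.add_sum_erase S (fun v => ∑ w ∈ S, (heads D v).count w) hy, ← spanned_underlying,
      Finset.card_erase_of_mem hy]
    omega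
  have h3 : (S.erase y).card ≤ ∑ v ∈ S.erase y, ∑ w ∈ S, (heads D v).count w := by
    simpa using Finset.card_nsmul_le_sum _ _ 1 h1
  have h4 : ∑ w ∈ S, (heads D y).count w = 0 := by omega
  have h5 : ∀ v ∈ S.erase y, ∑ w ∈ S, (heads D v).count w = 1 := by
    intro v hv
    have := (Finset.sum_eq_sum_iff_of_le (f := fun _ => 1)
      (g := fun v => ∑ w ∈ S, (heads D v).count w) h1).1 (by simp; omega) v hv
    exact this.symm
  have h6 : ∀ w ∈ S, w ∉ heads D y := fun w hw =>
    Multiset.count_eq_zero.1 ((Finset.sum_eq_zero_iff.1 h4) w hw)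
  refine ⟨h6, fun v hv w hw hwv w' hw' => ?_⟩
  have hvy : v ≠ y := by rintro rfl; exact h6 w hw hwv
  have h7 := h5 v (Finset.mem_erase.2 ⟨hvy, hv⟩)
  have h8 := Multiset.one_le_count_iff_mem.2 hwv
  rw [← Finset.add_sum_erase S _ hw] at h7
  have h9 : ∑ w ∈ S.erase w, (heads D v).count w = 0 := by omega
  split_ifs with he
  · subst he; omega
  · exact (Finset.sum_eq_zero_iff.1 h9) w' (Finset.mem_erase.2 ⟨he, hw'⟩)

/-- Two walks of `D` from the same vertex to an acyclic vertex agree. -/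
theorem walk_unique {D : OutDigraph n} {x : Fin n} {l a b : ℕ}
    (hx : ¬ Cyclic (underlying D) (2 * l + 2) x) {q q' : ℕ → Fin n} (hq : Follows D a q)
    (hq' : Follows D b q') (h0 : q 0 = q' 0) (hqa : q a = x) (hqb : q' b = x) (ha : a ≤ l)
    (hb : b ≤ l) : a = b ∧ ∀ i ≤ a, q i = q' i := by
  classical
  set S : Finset (Fin n) := (Finset.range (a + 1)).image q ∪ (Finset.range (b + 1)).image q' with hSdef
  have hqS : ∀ i ≤ a, q i ∈ S := fun i hi =>
    Finset.mem_union_left _ (Finset.mem_image_of_mem _ (Finset.mem_range.2 (by omega)))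
  have hqS' : ∀ i ≤ b, q' i ∈ S := fun i hi =>
    Finset.mem_union_right _ (Finset.mem_image_of_mem _ (Finset.mem_range.2 (by omega)))
  have hmem : ∀ v ∈ S, (∃ i ≤ a, q i = v) ∨ ∃ i ≤ b, q' i = v := by
    intro v hv
    simp only [hSdef, Finset.mem_union, Finset.mem_image, Finset.mem_range] at hv
    rcases hv with ⟨i, hi, rfl⟩ | ⟨i, hi, rfl⟩
    · exact Or.inl ⟨i, by omega, rfl⟩
    · exact Or.inr ⟨i, by omega, rfl⟩
  -- Two walks of length at most `l` have at most `l + 1` vertices each; this is where the radius `2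
  -- * l + 2` comes from.
  have hcard : S.card ≤ 2 * l + 2 := by
    refine (Finset.card_union_le _ _).trans ?_
    have h1 := Finset.card_image_le (s := Finset.range (a + 1)) (f := q)
    have h2 := Finset.card_image_le (s := Finset.range (b + 1)) (f := q')
    simp only [Finset.card_range] at h1 h2
    omega
  have hxS : x ∈ S := hqa ▸ hqS a le_rfl
  have hconn : ((underlying D).toSimple.induce (S : Set (Fin n))).Connected := by
    rw [SimpleGraph.connected_iff_exists_forall_reachable]
    refine ⟨⟨q 0, hqS 0 (Nat.zero_le _)⟩, ?_⟩
    rintro ⟨v, hv⟩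
    rcases hmem v hv with ⟨i, hi, rfl⟩ | ⟨i, hi, rfl⟩
    · exact hq.connected (S := (S : Set (Fin n))) hqS hi
    · have := hq'.connected (S := (S : Set (Fin n))) hqS' hi
      simp only [h0]
      exact this
  have hlt : (underlying D).spanned S < S.card := by
    by_contra hcon
    exact hx ⟨S, hxS, hcard, hconn, not_lt.1 hcon⟩
  -- Each vertex of `S` other than `x` has its successor on a walk as a head in `S`. By the count it
  -- has no other one, so both walks follow the same arcs, and neither can continue beyond `x`.
  obtain ⟨hA, hB⟩ := heads_of_spanned_lt hlt hxS (by
    intro v hv hvx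
    rcases hmem v hv with ⟨i, hi, rfl⟩ | ⟨i, hi, rfl⟩
    · have hia : i ≠ a := by rintro rfl; exact hvx hqa
      exact ⟨_, hqS (i + 1) (by omega), hq i (by omega)⟩
    · have hia : i ≠ b := by rintro rfl; exact hvx hqb
      exact ⟨_, hqS' (i + 1) (by omega), hq' i (by omega)⟩)
  have heq : ∀ i, i ≤ a → i ≤ b → q i = q' i := by
    intro i
    induction i with
    | zero => intro _ _; exact h0
    | succ i ih =>
      intro h1 h2
      have h3 := ih (by omega) (by omega)
      have h4 := hq i (by omega)
      have h5 := hq' i (by omega)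
      rw [← h3] at h5
      have h6 := hB _ (hqS i (by omega)) _ (hqS (i + 1) h1) h4 _ (hqS' (i + 1) h2)
      by_contra hne
      rw [if_neg (fun h => hne h.symm)] at h6
      exact Multiset.count_eq_zero.1 h6 h5
  rcases lt_trichotomy a b with hlt | he | hlt
  · exfalso
    have h1 := hq' a hlt
    rw [← heq a le_rfl hlt.le, hqa] at h1
    exact hA _ (hqS' _ (by omega)) h1
  · exact ⟨he, fun i hi => heq i hi (by omega)⟩
  · exfalso
    have h1 := hq b hlt
    rw [heq b hlt.le le_rfl, hqb] at h1
    exact hA _ (hqS _ (by omega)) h1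

/-- The arcs between the vertices of a shortest walk from an acyclic vertex are those of the walk. -/
theorem count_heads_of_isDist {D : OutDigraph n} {l : ℕ} {p : ℕ → Fin n}
    (hx : ¬ Cyclic (underlying D) (2 * l + 2) (p 0)) (hp : Follows D l p)
    (hd : IsDist D l (p 0) (p l)) {i j : ℕ} (hi : i < l) (hj : j ≤ l) :
    (heads D (p i)).count (p j) = if j = i + 1 then 1 else 0 := by
  classical
  have hinj := hp.injOn_of_isDist hd
  set S : Finset (Fin n) := (Finset.range (l + 1)).image p with hSdef
  have hpS : ∀ i ≤ l, p i ∈ S := fun i hi =>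
    Finset.mem_image_of_mem _ (Finset.mem_range.2 (by omega))
  have hcard : S.card ≤ 2 * l + 2 := by
    refine Finset.card_image_le.trans ?_
    rw [Finset.card_range]; omega
  have hmem : ∀ v ∈ S, ∃ i ≤ l, p i = v := by
    intro v hv
    simp only [hSdef, Finset.mem_image, Finset.mem_range] at hv
    obtain ⟨i, hi, rfl⟩ := hv
    exact ⟨i, by omega, rfl⟩
  have hconn : ((underlying D).toSimple.induce (S : Set (Fin n))).Connected := by
    rw [SimpleGraph.connected_iff_exists_forall_reachable]
    refine ⟨⟨p 0, hpS 0 (Nat.zero_le _)⟩, ?_⟩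
    rintro ⟨v, hv⟩
    obtain ⟨i, hi, rfl⟩ := hmem v hv
    exact hp.connected (S := (S : Set (Fin n))) hpS hi
  have hlt : (underlying D).spanned S < S.card := by
    by_contra hcon
    exact hx ⟨S, hpS 0 (Nat.zero_le _), hcard, hconn, not_lt.1 hcon⟩
  obtain ⟨-, hB⟩ := heads_of_spanned_lt hlt (hpS l le_rfl) (by
    intro v hv hvx
    obtain ⟨i, hi, rfl⟩ := hmem v hv
    have hil : i ≠ l := by rintro rfl; exact hvx rfl
    exact ⟨_, hpS (i + 1) (by omega), hp i (by omega)⟩)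
  rw [hB _ (hpS i hi.le) _ (hpS (i + 1) hi) (hp i hi) _ (hpS j hj)]
  have : p j = p (i + 1) ↔ j = i + 1 := hinj.eq_iff (Set.mem_Iic.2 hj) (Set.mem_Iic.2 hi)
  simp only [this]

/-! ### Gluing connected sets. -/

theorem countP_add_countP_le {α : Type*} (p q r : α → Prop) [DecidablePred p] [DecidablePred q]
    [DecidablePred r] (s : Multiset α) (hpq : ∀ a ∈ s, p a → ¬ q a)
    (hr : ∀ a ∈ s, p a ∨ q a → r a) :
    s.countP p + s.countP q ≤ s.countP r := by
  induction s using Multiset.induction_on with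
  | empty => simp
  | cons a s ih =>
    have ih' := ih (fun b hb => hpq b (Multiset.mem_cons_of_mem hb))
      (fun b hb => hr b (Multiset.mem_cons_of_mem hb))
    have h1 := hpq a (Multiset.mem_cons_self a s)
    have h2 := hr a (Multiset.mem_cons_self a s)
    rw [Multiset.countP_cons, Multiset.countP_cons, Multiset.countP_cons]
    by_cases hp : p a <;> by_cases hq : q a <;> by_cases hr : r a <;> simp_all <;> omega

theorem MGraph.spanned_union_of_adj (G : MGraph n) {S T : Finset (Fin n)} (hST : Disjoint S T)
    {u v : Fin n} (hu : u ∈ S) (hv : v ∈ T) (huv : G.Adj u v) :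
    G.spanned S + G.spanned T + 1 ≤ G.spanned (S ∪ T) := by
  classical
  obtain ⟨H, rfl⟩ := Multiset.exists_cons_of_mem huv
  have hvS : v ∉ S := fun h => Finset.disjoint_left.1 hST h hv
  have huT : u ∉ T := fun h => Finset.disjoint_left.1 hST hu h
  unfold MGraph.spanned
  rw [Multiset.countP_cons_of_neg _ (by simp [hvS]),
    Multiset.countP_cons_of_neg _ (by simp [huT]),
    Multiset.countP_cons_of_pos _ (by simp [hu, hv])]
  refine Nat.add_le_add_right (countP_add_countP_le _ _ _ H ?_ ?_) 1
  · intro e _ h1 h2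
    induction e using Sym2.ind with
    | _ a b => exact Finset.disjoint_left.1 hST (h1 a (by simp)) (h2 a (by simp))
  · rintro e _ (h | h) w hw
    · exact Finset.mem_union_left _ (h w hw)
    · exact Finset.mem_union_right _ (h w hw)

/-- `S` induces a connected subgraph of `G`. -/
def MGraph.Conn (G : MGraph n) (S : Finset (Fin n)) : Prop :=
  (G.toSimple.induce (S : Set (Fin n))).Connected

theorem MGraph.Conn.union_of_adj {G : MGraph n} {S T : Finset (Fin n)} (hS : G.Conn S)
    (hT : G.Conn T) {u v : Fin n} (hu : u ∈ S) (hv : v ∈ T) (huv : G.Adj u v) :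
    G.Conn (S ∪ T) := by
  unfold MGraph.Conn at *
  rw [SimpleGraph.connected_iff_exists_forall_reachable]
  have hu' : u ∈ ((S ∪ T : Finset (Fin n)) : Set (Fin n)) := by simp [hu]
  have hv' : v ∈ ((S ∪ T : Finset (Fin n)) : Set (Fin n)) := by simp [hv]
  have hS1 : (S : Set (Fin n)) ⊆ ((S ∪ T : Finset (Fin n)) : Set (Fin n)) := by simp
  have hT1 : (T : Set (Fin n)) ⊆ ((S ∪ T : Finset (Fin n)) : Set (Fin n)) := by simp
  refine ⟨⟨u, hu'⟩, ?_⟩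
  rintro ⟨w, hw⟩
  have hw2 := hw
  simp only [Finset.coe_union, Set.mem_union, Finset.mem_coe] at hw2
  rcases hw2 with hw2 | hw2
  · exact (hS.preconnected ⟨u, hu⟩ ⟨w, hw2⟩).map (SimpleGraph.induceHomOfLE _ hS1).toHom
  · exact (huv.reachable hu' hv').trans
      ((hT.preconnected ⟨v, hv⟩ ⟨w, hw2⟩).map (SimpleGraph.induceHomOfLE _ hT1).toHom)

theorem MGraph.Conn.union_of_mem {G : MGraph n} {S T : Finset (Fin n)} (hS : G.Conn S)
    (hT : G.Conn T) {u : Fin n} (hu : u ∈ S) (hv : u ∈ T) : G.Conn (S ∪ T) := by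
  unfold MGraph.Conn at *
  rw [Finset.coe_union]
  exact SimpleGraph.induce_union_connected hS.preconnected hT.preconnected ⟨u, hu, hv⟩

theorem MGraph.conn_singleton (G : MGraph n) (v : Fin n) : G.Conn {v} := by
  unfold MGraph.Conn
  rw [SimpleGraph.connected_iff_exists_forall_reachable]
  refine ⟨⟨v, by simp⟩, ?_⟩
  rintro ⟨w, hw⟩
  have : w = v := by simpa using hw
  subst this
  rfl

theorem MGraph.Conn.insert_of_adj {G : MGraph n} {S : Finset (Fin n)} (hS : G.Conn S)
    {u v : Fin n} (hu : u ∈ S) (huv : G.Adj u v) : G.Conn (insert v S) := by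
  rw [Finset.insert_eq, Finset.union_comm]
  exact hS.union_of_adj (G.conn_singleton v) hu (Finset.mem_singleton_self v) huv

theorem MGraph.adj_of_toSimple {G : MGraph n} {u v : Fin n} (h : G.toSimple.Adj u v) :
    G.Adj u v := by
  simp only [MGraph.toSimple, SimpleGraph.fromEdgeSet_adj] at h
  exact h.1

/-- Two disjoint cyclic sets joined by a walk yield a connected set with two cycles. -/
theorem exists_bicyclic {G : MGraph n} {T : Finset (Fin n)} (hT : G.Conn T)
    (hT' : T.card ≤ G.spanned T) {u v : Fin n} (w : G.toSimple.Walk u v) (hv : v ∈ T)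
    {S : Finset (Fin n)} (hS : G.Conn S) (hS' : S.card ≤ G.spanned S) (hu : u ∈ S)
    (hST : Disjoint S T) :
    ∃ U : Finset (Fin n), G.Conn U ∧ U.card + 1 ≤ G.spanned U ∧
      U.card ≤ S.card + T.card + w.length := by
  -- `S` absorbs the vertices of the walk one at a time, each with the edge that leads to it, so it
  -- keeps at least as many edges as vertices. The edge by which the walk enters `T` is then the
  -- surplus one.
  induction w generalizing S with
  | nil => exact absurd hv (Finset.disjoint_left.1 hST hu)
  | @cons u a v h p ih =>
    have hadj := MGraph.adj_of_toSimple h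
    by_cases haS : a ∈ S
    · obtain ⟨U, h1, h2, h3⟩ := ih hv hS hS' haS hST
      exact ⟨U, h1, h2, by rw [SimpleGraph.Walk.length_cons]; omega⟩
    by_cases haT : a ∈ T
    · refine ⟨S ∪ T, hS.union_of_adj hT hu haT hadj, ?_, ?_⟩
      · rw [Finset.card_union_of_disjoint hST]
        have := G.spanned_union_of_adj hST hu haT hadj
        omega
      · rw [Finset.card_union_of_disjoint hST]; omega
    · have h1 := G.spanned_union_of_adj (Finset.disjoint_singleton_right.2 haS) hu
        (Finset.mem_singleton_self a) hadj
      have h2 : S ∪ {a} = insert a S := by rw [Finset.union_comm]; rfl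
      rw [h2] at h1
      have h3 := Finset.card_insert_of_notMem haS
      obtain ⟨U, k1, k2, k3⟩ := ih hv (hS.insert_of_adj hu hadj) (by omega)
        (Finset.mem_insert_self a S) (Finset.disjoint_insert_left.2 ⟨haT, hST⟩)
      exact ⟨U, k1, k2, by rw [SimpleGraph.Walk.length_cons]; omega⟩

/-! ### Growth of out-balls around cyclic sets. -/

/-- The vertices reached from `S` by at most `j` arcs. -/
def outBall (D : OutDigraph n) (S : Finset (Fin n)) : ℕ → Finset (Fin n)
  | 0 => S
  | j + 1 => outBall D S j ∪ (outBall D S j).biUnion (fun u => (heads D u).toFinset)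

theorem mem_outBall_succ {D : OutDigraph n} {S : Finset (Fin n)} {j : ℕ} {u v : Fin n}
    (hu : u ∈ outBall D S j) (hv : v ∈ heads D u) : v ∈ outBall D S (j + 1) :=
  Finset.mem_union_right _ (Finset.mem_biUnion.2 ⟨u, hu, Multiset.mem_toFinset.2 hv⟩)

theorem exists_walk_of_mem_outBall {D : OutDigraph n} {S : Finset (Fin n)} {j : ℕ} {v : Fin n}
    (hv : v ∈ outBall D S j) :
    ∃ u ∈ S, ∃ w : (underlying D).toSimple.Walk u v, w.length ≤ j := by
  induction j generalizing v with
  | zero => exact ⟨v, hv, SimpleGraph.Walk.nil, le_rfl⟩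
  | succ j ih =>
    rcases Finset.mem_union.1 hv with h | h
    · obtain ⟨u, hu, w, hw⟩ := ih h
      exact ⟨u, hu, w, by omega⟩
    · obtain ⟨a, ha, h⟩ := Finset.mem_biUnion.1 h
      obtain ⟨u, hu, w, hw⟩ := ih ha
      by_cases hav : a = v
      · subst hav; exact ⟨u, hu, w, by omega⟩
      · have hadj : (underlying D).toSimple.Adj a v := by
          simp only [MGraph.toSimple, SimpleGraph.fromEdgeSet_adj]
          exact ⟨adj_underlying_of_mem (Multiset.mem_toFinset.1 h), hav⟩
        exact ⟨u, hu, w.concat hadj, by rw [SimpleGraph.Walk.length_concat]; omega⟩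

/-- A connected set that contains `S₀`, and in which each vertex outside `S₀` is a head. -/
structure Grounded (D : OutDigraph n) (S₀ S : Finset (Fin n)) : Prop where
  subset : S₀ ⊆ S
  conn : (underlying D).Conn S
  head : ∀ v ∈ S, v ∉ S₀ → ∃ u ∈ S, v ∈ heads D u

theorem Grounded.union {D : OutDigraph n} {S₀ S T : Finset (Fin n)} (hS : Grounded D S₀ S)
    (hT : Grounded D S₀ T) (hne : S₀.Nonempty) : Grounded D S₀ (S ∪ T) where
  subset := hS.subset.trans Finset.subset_union_left
  conn := by
    obtain ⟨u, hu⟩ := hne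
    exact hS.conn.union_of_mem hT.conn (hS.subset hu) (hT.subset hu)
  head := by
    intro v hv hv0
    rcases Finset.mem_union.1 hv with h | h
    · obtain ⟨u, hu, huv⟩ := hS.head v h hv0
      exact ⟨u, Finset.mem_union_left _ hu, huv⟩
    · obtain ⟨u, hu, huv⟩ := hT.head v h hv0
      exact ⟨u, Finset.mem_union_right _ hu, huv⟩

theorem exists_grounded {D : OutDigraph n} {S₀ : Finset (Fin n)} (hS₀ : (underlying D).Conn S₀)
    {j : ℕ} {v : Fin n} (hv : v ∈ outBall D S₀ j) :
    ∃ S, Grounded D S₀ S ∧ v ∈ S ∧ (S \ S₀).card ≤ j := by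
  induction j generalizing v with
  | zero => exact ⟨S₀, ⟨subset_rfl, hS₀, fun v h h' => absurd h h'⟩, hv, by simp⟩
  | succ j ih =>
    rcases Finset.mem_union.1 hv with h | h
    · obtain ⟨S, h1, h2, h3⟩ := ih h
      exact ⟨S, h1, h2, by omega⟩
    · obtain ⟨a, ha, h⟩ := Finset.mem_biUnion.1 h
      rw [Multiset.mem_toFinset] at h
      obtain ⟨S, h1, h2, h3⟩ := ih ha
      refine ⟨insert v S, ⟨h1.subset.trans (Finset.subset_insert _ _),
        h1.conn.insert_of_adj h2 (adj_underlying_of_mem h), ?_⟩, Finset.mem_insert_self _ _, ?_⟩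
      · intro w hw hw0
        rcases Finset.mem_insert.1 hw with rfl | hw
        · exact ⟨a, Finset.mem_insert_of_mem h2, h⟩
        · obtain ⟨u, hu, huw⟩ := h1.head w hw hw0
          exact ⟨u, Finset.mem_insert_of_mem hu, huw⟩
      · have : insert v S \ S₀ ⊆ insert v (S \ S₀) := by
          intro w; simp only [Finset.mem_sdiff, Finset.mem_insert]; tauto
        exact (Finset.card_le_card this).trans ((Finset.card_insert_le _ _).trans (by omega))

/-- In a sparse graph, the arcs that leave a cyclic set form a forest. -/
theorem Grounded.forest {D : OutDigraph n} {S₀ S : Finset (Fin n)} (hS : Grounded D S₀ S)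
    (hcyc : S₀.card ≤ (underlying D).spanned S₀) (hle : (underlying D).spanned S ≤ S.card) :
    (∀ h ∈ S₀, ∀ u ∈ S, u ∉ S₀ → h ∉ heads D u) ∧
      ∀ h ∈ S, h ∉ S₀ → ∑ u ∈ S, (heads D u).count h ≤ 1 := by
  classical
  -- Sort the spanned arcs by their heads. Those within `S₀` number at least |S₀|, and each vertex
  -- of `S \ S₀` is a head at least once, which already makes |S|. As no more are allowed, no arc
  -- enters `S₀` from `S \ S₀` and no vertex of `S \ S₀` is a head twice.
  have h1 : (underlying D).spanned S = ∑ h ∈ S₀, ∑ u ∈ S, (heads D u).count h +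
      ∑ h ∈ S \ S₀, ∑ u ∈ S, (heads D u).count h := by
    rw [spanned_underlying, Finset.sum_comm, add_comm, Finset.sum_sdiff hS.subset]
  have h2 : ∑ h ∈ S₀, ∑ u ∈ S, (heads D u).count h =
      (underlying D).spanned S₀ + ∑ h ∈ S₀, ∑ u ∈ S \ S₀, (heads D u).count h := by
    rw [spanned_underlying, Finset.sum_comm (s := S₀) (t := S₀), ← Finset.sum_add_distrib]
    refine Finset.sum_congr rfl fun h _ => ?_
    rw [add_comm, Finset.sum_sdiff hS.subset]
  have h3 : ∀ h ∈ S \ S₀, 1 ≤ ∑ u ∈ S, (heads D u).count h := by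
    intro h hh
    obtain ⟨u, hu, huh⟩ := hS.head h (Finset.mem_sdiff.1 hh).1 (Finset.mem_sdiff.1 hh).2
    exact (Multiset.one_le_count_iff_mem.2 huh).trans
      (Finset.single_le_sum (f := fun u => (heads D u).count h) (fun _ _ => Nat.zero_le _) hu)
  have h4 : (S \ S₀).card ≤ ∑ h ∈ S \ S₀, ∑ u ∈ S, (heads D u).count h := by
    simpa using Finset.card_nsmul_le_sum _ _ 1 h3
  have h5 : (S \ S₀).card + S₀.card = S.card := Finset.card_sdiff_add_card_eq_card hS.subset
  refine ⟨fun h hh u hu hu0 hmem => ?_, fun h hh hh0 => ?_⟩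
  · have h6 : ∑ h ∈ S₀, ∑ u ∈ S \ S₀, (heads D u).count h = 0 := by omega
    have h7 := Finset.sum_eq_zero_iff.1 (Finset.sum_eq_zero_iff.1 h6 h hh) u
      (Finset.mem_sdiff.2 ⟨hu, hu0⟩)
    exact Multiset.count_eq_zero.1 h7 hmem
  · have h6 : ∑ h ∈ S \ S₀, ∑ u ∈ S, (heads D u).count h = ∑ h ∈ S \ S₀, 1 := by simp; omega
    have h7 := (Finset.sum_eq_sum_iff_of_le h3).1 h6.symm h (Finset.mem_sdiff.2 ⟨hh, hh0⟩)
    exact h7.symm.le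

theorem exists_pair_of_two_le_sum {α : Type*} [DecidableEq α] {B : Finset α} {f : α → ℕ}
    (h : 2 ≤ ∑ u ∈ B, f u) : ∃ u ∈ B, ∃ u' ∈ B, 2 ≤ ∑ w ∈ {u, u'}, f w := by
  obtain ⟨u, hu, hu0⟩ : ∃ u ∈ B, f u ≠ 0 := Finset.exists_ne_zero_of_sum_ne_zero (by omega)
  by_cases h2 : 2 ≤ f u
  · exact ⟨u, hu, u, hu, by simpa using h2⟩
  · rw [← Finset.add_sum_erase B f hu] at h
    obtain ⟨u', hu', hu0'⟩ : ∃ u' ∈ B.erase u, f u' ≠ 0 :=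
      Finset.exists_ne_zero_of_sum_ne_zero (by omega)
    refine ⟨u, hu, u', Finset.mem_of_mem_erase hu', ?_⟩
    rw [Finset.sum_pair (Finset.ne_of_mem_erase hu').symm]
    omega

theorem two_le_card_heads (D : OutDigraph n) (v : Fin n) : 2 ≤ Multiset.card (heads D v) := by
  unfold heads
  rcases D v with f | f <;> simp

section Expansion

variable {D : OutDigraph n} {b : ℕ}

/-- Connected sets of at most `b` vertices span at most one cycle. -/
def Sparse (G : MGraph n) (b : ℕ) : Prop :=
  ∀ U : Finset (Fin n), U.card ≤ b → G.Conn U → G.spanned U ≤ U.card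

/-- Count the arcs leaving the vertices of the ball outside `S₀`. There are at least two from each;
none returns to `S₀`, and no two share a head, since either event would create a second cycle in a
small connected set. -/
theorem two_mul_card_outBall_sdiff_le (hG : Sparse (underlying D) b) {S₀ : Finset (Fin n)}
    (hS₀ : (underlying D).Conn S₀) (hcyc : S₀.card ≤ (underlying D).spanned S₀)
    (hne : S₀.Nonempty) {j : ℕ} (hb : S₀.card + 3 * (j + 1) ≤ b) :
    2 * (outBall D S₀ j \ S₀).card ≤ (outBall D S₀ (j + 1) \ S₀).card := by
  classical
  -- The budget `3 * (j + 1)` pays for three paths from `S₀`: to two tails and to their common head.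
  have hsize : ∀ S, Grounded D S₀ S → (S \ S₀).card ≤ 3 * (j + 1) →
      (underlying D).spanned S ≤ S.card := fun S hS hc =>
    hG S (by have := Finset.card_sdiff_add_card_eq_card hS.subset; omega) hS.conn
  have h1 : ∀ u ∈ outBall D S₀ j \ S₀, 2 ≤ ∑ h ∈ outBall D S₀ (j + 1) \ S₀, (heads D u).count h := by
    intro u hu
    obtain ⟨hu, hu0⟩ := Finset.mem_sdiff.1 hu
    refine (two_le_card_heads D u).trans_eq (Multiset.sum_count_eq_card ?_).symm
    intro h hh
    refine Finset.mem_sdiff.2 ⟨mem_outBall_succ hu hh, fun h0 => ?_⟩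
    obtain ⟨S, hS, huS, hc⟩ := exists_grounded hS₀ hu
    exact (hS.forest hcyc (hsize S hS (by omega))).1 h h0 u huS hu0 hh
  have h2 : ∀ h ∈ outBall D S₀ (j + 1) \ S₀, ∑ u ∈ outBall D S₀ j \ S₀, (heads D u).count h ≤ 1 := by
    intro h hh
    obtain ⟨hh, hh0⟩ := Finset.mem_sdiff.1 hh
    by_contra hcon
    obtain ⟨u, hu, u', hu', h2⟩ := exists_pair_of_two_le_sum (not_le.1 hcon)
    obtain ⟨S, hS, huS, hc⟩ := exists_grounded hS₀ (Finset.mem_sdiff.1 hu).1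
    obtain ⟨S', hS', huS', hc'⟩ := exists_grounded hS₀ (Finset.mem_sdiff.1 hu').1
    obtain ⟨T, hT, hT', hcT⟩ := exists_grounded hS₀ hh
    have hU := (hS.union hS' hne).union hT hne
    have hcard : ((S ∪ S' ∪ T) \ S₀).card ≤ 3 * (j + 1) := by
      rw [Finset.union_sdiff_distrib, Finset.union_sdiff_distrib]
      have k1 := Finset.card_union_le (S \ S₀ ∪ S' \ S₀) (T \ S₀)
      have k2 := Finset.card_union_le (S \ S₀) (S' \ S₀)
      omega
    have h3 := (hU.forest hcyc (hsize _ hU hcard)).2 h (Finset.mem_union_right _ hT') hh0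
    have h4 : ∑ w ∈ {u, u'}, (heads D w).count h ≤ ∑ w ∈ S ∪ S' ∪ T, (heads D w).count h := by
      refine Finset.sum_le_sum_of_subset ?_
      intro w hw
      rcases Finset.mem_insert.1 hw with rfl | hw
      · simp [huS]
      · rw [Finset.mem_singleton.1 hw]; simp [huS']
    omega
  calc 2 * (outBall D S₀ j \ S₀).card
      ≤ ∑ u ∈ outBall D S₀ j \ S₀, ∑ h ∈ outBall D S₀ (j + 1) \ S₀, (heads D u).count h := by
        rw [mul_comm]; simpa using Finset.card_nsmul_le_sum _ _ 2 h1
    _ = ∑ h ∈ outBall D S₀ (j + 1) \ S₀, ∑ u ∈ outBall D S₀ j \ S₀, (heads D u).count h :=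
        Finset.sum_comm
    _ ≤ (outBall D S₀ (j + 1) \ S₀).card := by
        simpa using Finset.sum_le_card_nsmul _ _ 1 h2

theorem two_pow_le_card_outBall (hG : Sparse (underlying D) b) {S₀ : Finset (Fin n)}
    (hS₀ : (underlying D).Conn S₀) (hcyc : S₀.card ≤ (underlying D).spanned S₀)
    (hne : S₀.Nonempty) {j : ℕ} (hb : S₀.card + 3 * (j + 1) ≤ b) :
    2 ^ j ≤ (outBall D S₀ (j + 1) \ S₀).card := by
  classical
  induction j with
  | zero =>
    rw [pow_zero, Nat.one_le_iff_ne_zero, Ne, Finset.card_eq_zero]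
    -- If no arc left `S₀`, then `S₀` would span at least 2|S₀| edges, more than sparsity allows.
    intro hemp
    have h1 := hG S₀ (by omega) hS₀
    have h2 : ∀ u ∈ S₀, 2 ≤ ∑ h ∈ S₀, (heads D u).count h := by
      intro u hu
      refine (two_le_card_heads D u).trans_eq (Multiset.sum_count_eq_card ?_).symm
      intro h hh
      exact Finset.sdiff_eq_empty_iff_subset.1 hemp (mem_outBall_succ (j := 0) hu hh)
    have h3 : S₀.card * 2 ≤ (underlying D).spanned S₀ := by
      rw [spanned_underlying]
      simpa using Finset.card_nsmul_le_sum _ _ 2 h2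
    have := hne.card_pos
    omega
  | succ j ih =>
    have h1 := ih (by omega)
    have h2 := two_mul_card_outBall_sdiff_le hG hS₀ hcyc hne hb
    rw [pow_succ]; omega

/-- A common vertex would give a walk of length at most `2 * j` between two disjoint cyclic sets,
hence a small connected set with two cycles. -/
theorem disjoint_outBall (hG : Sparse (underlying D) b) {S T : Finset (Fin n)}
    (hS : (underlying D).Conn S) (hS' : S.card ≤ (underlying D).spanned S)
    (hT : (underlying D).Conn T) (hT' : T.card ≤ (underlying D).spanned T)
    (hST : Disjoint S T) {j : ℕ} (hb : S.card + T.card + 2 * j ≤ b) :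
    Disjoint (outBall D S j) (outBall D T j) := by
  rw [Finset.disjoint_left]
  intro h h1 h2
  obtain ⟨u, hu, w, hw⟩ := exists_walk_of_mem_outBall h1
  obtain ⟨v, hv, w', hw'⟩ := exists_walk_of_mem_outBall h2
  obtain ⟨U, k1, k2, k3⟩ := exists_bicyclic hT hT' (w.append w'.reverse) hv hS hS' hu hST
  rw [SimpleGraph.Walk.length_append, SimpleGraph.Walk.length_reverse] at k3
  have := hG U (by omega) k1
  omega

end Expansion

/-! ### Counting the vertices near short cycles. -/

open Classical in
/-- The neighbours of `v`. -/
noncomputable def nbrs (G : MGraph n) (v : Fin n) : Finset (Fin n) :=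
  Finset.univ.filter (G.Adj v)

theorem card_nbrs_le (G : MGraph n) (v : Fin n) : (nbrs G v).card ≤ G.degree v := by
  classical
  have h1 : (nbrs G v).card ≤ (Multiset.filter (fun e => v ∈ e) G).toFinset.card := by
    refine Finset.card_le_card_of_injOn (fun w => s(v, w)) ?_ ?_
    · intro w hw
      have hw' : G.Adj v w := by simpa [nbrs] using hw
      simp only [Finset.mem_coe, Multiset.mem_toFinset, Multiset.mem_filter]
      exact ⟨hw', by simp⟩
    · intro w _ w' _ h
      exact Sym2.congr_right.1 h
  refine h1.trans ((Multiset.toFinset_card_le _).trans ?_)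
  rw [← Multiset.countP_eq_card_filter]
  exact Nat.le_add_right _ _

/-- The vertices at distance at most `R` from `x`. -/
noncomputable def ball (G : MGraph n) : ℕ → Fin n → Finset (Fin n)
  | 0, x => {x}
  | R + 1, x => insert x ((nbrs G x).biUnion (ball G R))

theorem card_ball_le {G : MGraph n} {d : ℕ} (hd : ∀ v, G.degree v ≤ d) (R : ℕ) (x : Fin n) :
    (ball G R x).card ≤ (d + 1) ^ R := by
  induction R generalizing x with
  | zero => simp [ball]
  | succ R ih =>
    refine (Finset.card_insert_le _ _).trans ?_
    have h1 : ((nbrs G x).biUnion (ball G R)).card ≤ (nbrs G x).card * (d + 1) ^ R :=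
      Finset.card_biUnion_le_card_mul _ _ _ fun y _ => ih y
    have h2 := Nat.mul_le_mul_right ((d + 1) ^ R) ((card_nbrs_le G x).trans (hd x))
    have h3 : 1 ≤ (d + 1) ^ R := Nat.one_le_pow _ _ (by omega)
    rw [pow_succ]; nlinarith

theorem mem_ball_of_walk {G : MGraph n} {x y : Fin n} (w : G.toSimple.Walk x y) {R : ℕ}
    (hw : w.length ≤ R) : y ∈ ball G R x := by
  induction w generalizing R with
  | nil => cases R <;> simp [ball]
  | @cons u a v h p ih =>
    rw [SimpleGraph.Walk.length_cons] at hw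
    obtain ⟨R, rfl⟩ : ∃ R', R = R' + 1 := ⟨R - 1, by omega⟩
    refine Finset.mem_insert_of_mem (Finset.mem_biUnion.2 ⟨a, ?_, ih (by omega)⟩)
    simp only [nbrs, Finset.mem_filter, Finset.mem_univ, true_and]
    exact MGraph.adj_of_toSimple h

theorem MGraph.Conn.exists_walk {G : MGraph n} {S : Finset (Fin n)} (hS : G.Conn S) {u v : Fin n}
    (hu : u ∈ S) (hv : v ∈ S) : ∃ w : G.toSimple.Walk u v, w.length ≤ S.card := by
  classical
  obtain ⟨w⟩ := hS.preconnected ⟨u, hu⟩ ⟨v, hv⟩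
  refine ⟨(w.toPath.1.map (SimpleGraph.Embedding.induce _).toHom), ?_⟩
  refine (SimpleGraph.Walk.length_map _ _).le.trans ?_
  have := w.toPath.2.length_lt
  simp only [Finset.coe_sort_coe, Fintype.card_coe] at this
  exact this.le

/-- Sparse graphs of small degree have few vertices near short cycles. -/
theorem card_cyclic_mul_le {D : OutDigraph n} {b r t d : ℕ} (hG : Sparse (underlying D) b)
    (hb : 2 * r + 3 * (t + 1) ≤ b) (hd : ∀ v, (underlying D).degree v ≤ d) :
    ({x | Cyclic (underlying D) r x} : Set (Fin n)).ncard * 2 ^ t ≤ n * (d + 1) ^ (2 * r) := by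
  classical
  set Bad : Finset (Fin n) := Finset.univ.filter (Cyclic (underlying D) r) with hBad
  have hBad' : ({x | Cyclic (underlying D) r x} : Set (Fin n)).ncard = Bad.card := by
    rw [← Set.ncard_coe_finset]; congr 1; ext x; simp [hBad]
  rw [hBad']
  have hex : ∀ x, ∃ S : Finset (Fin n), x ∈ Bad → (x ∈ S ∧ S.card ≤ r ∧ (underlying D).Conn S ∧
      S.card ≤ (underlying D).spanned S) := by
    intro x
    by_cases hx : x ∈ Bad
    · obtain ⟨S, hS⟩ := (Finset.mem_filter.1 hx).2
      exact ⟨S, fun _ => hS⟩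
    · exact ⟨∅, fun h => absurd h hx⟩
  choose S hS using hex
  -- A largest family of bad vertices with pairwise disjoint cyclic sets. By maximality every other
  -- cyclic set meets one of these, so each bad vertex is within distance `2 * r` of `M`; the
  -- disjoint out-balls bound |M|.
  obtain ⟨M, hM, hmax⟩ := Finset.exists_max_image
    (Bad.powerset.filter fun M : Finset (Fin n) => (M : Set (Fin n)).PairwiseDisjoint S)
    Finset.card
    ⟨∅, by simp⟩
  simp only [Finset.mem_filter, Finset.mem_powerset] at hM hmax
  obtain ⟨hMB, hMd⟩ := hM
  have hmeet : ∀ y ∈ Bad, ∃ x ∈ M, ¬ Disjoint (S x) (S y) := by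
    intro y hy
    by_contra! hcon
    have hyM : y ∉ M := fun h =>
      Finset.disjoint_left.1 (hcon y h) (hS y hy).1 (hS y hy).1
    have := hmax (insert y M) ⟨Finset.insert_subset hy hMB, by
      rw [Finset.coe_insert, Set.pairwiseDisjoint_insert_of_notMem (by simpa using hyM)]
      exact ⟨hMd, fun j hj => (hcon j hj).symm⟩⟩
    rw [Finset.card_insert_of_notMem hyM] at this
    omega
  have hcover : Bad ⊆ M.biUnion (ball (underlying D) (2 * r)) := by
    intro y hy
    obtain ⟨x, hx, hxy⟩ := hmeet y hy
    obtain ⟨u, hux, huy⟩ := Finset.not_disjoint_iff.1 hxy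
    have hSx := hS x (hMB hx)
    have hSy := hS y hy
    obtain ⟨w, hw⟩ := hSx.2.2.1.exists_walk hSx.1 hux
    obtain ⟨w', hw'⟩ := hSy.2.2.1.exists_walk huy hSy.1
    refine Finset.mem_biUnion.2 ⟨x, hx, mem_ball_of_walk (w.append w') ?_⟩
    rw [SimpleGraph.Walk.length_append]; omega
  have h1 : Bad.card ≤ M.card * (d + 1) ^ (2 * r) :=
    (Finset.card_le_card hcover).trans
      (Finset.card_biUnion_le_card_mul _ _ _ fun y _ => card_ball_le hd _ y)
  have h2 : M.card * 2 ^ t ≤ n := by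
    have hdis : (M : Set (Fin n)).PairwiseDisjoint fun x => outBall D (S x) (t + 1) := by
      intro x hx y hy hxy
      have hSx := hS x (hMB hx)
      have hSy := hS y (hMB hy)
      exact disjoint_outBall hG hSx.2.2.1 hSx.2.2.2 hSy.2.2.1 hSy.2.2.2 (hMd hx hy hxy) (by omega)
    calc M.card * 2 ^ t ≤ ∑ x ∈ M, (outBall D (S x) (t + 1)).card := by
          refine (Finset.card_nsmul_le_sum M _ (2 ^ t) fun x hx => ?_)
          have hSx := hS x (hMB hx)
          exact (two_pow_le_card_outBall hG hSx.2.2.1 hSx.2.2.2 ⟨x, hSx.1⟩ (by omega)).trans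
            (Finset.card_le_card Finset.sdiff_subset)
      _ = (M.biUnion fun x => outBall D (S x) (t + 1)).card := (Finset.card_biUnion hdis).symm
      _ ≤ n := by simpa using Finset.card_le_univ (M.biUnion fun x => outBall D (S x) (t + 1))
  calc Bad.card * 2 ^ t ≤ M.card * (d + 1) ^ (2 * r) * 2 ^ t := Nat.mul_le_mul_right _ h1
    _ = M.card * 2 ^ t * (d + 1) ^ (2 * r) := by ring
    _ ≤ n * (d + 1) ^ (2 * r) := Nat.mul_le_mul_right _ h2

/-! ### Reversal of a path. -/

/-- Apply a function to all heads of the out-arcs of a vertex. -/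
def mapHeads (g : Fin n → Fin n) :
    (Fin 2 → Fin n) ⊕ (Fin 3 → Fin n) → (Fin 2 → Fin n) ⊕ (Fin 3 → Fin n) :=
  Sum.map (fun f i => g (f i)) (fun f i => g (f i))

/-- `D'` results from `D` by reversing the walk `p` of length `l`; the out-arc used at its first
vertex has index `i`. -/
structure Reversal (D D' : OutDigraph n) (l : ℕ) (p : ℕ → Fin n) (i : Fin 3) : Prop where
  off : ∀ v, (∀ m ≤ l, p m ≠ v) → D' v = D v
  first : ∃ f : Fin 3 → Fin n, D (p 0) = Sum.inr f ∧ f i = p 1 ∧ D' (p 0) = Sum.inl (i.removeNth f)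
  last : ∃ f : Fin 2 → Fin n, D (p l) = Sum.inl f ∧
    D' (p l) = Sum.inr (Fin.cons (α := fun _ => Fin n) (p (l - 1)) f)
  mid : ∀ m, 0 < m → m < l →
    D' (p m) = mapHeads (fun w => if w = p (m + 1) then p (m - 1) else w) (D (p m))

theorem exists_reversal {D : OutDigraph n} {l : ℕ} {p : ℕ → Fin n} (hl : 0 < l)
    (hp : Follows D l p) (hinj : Set.InjOn p (Set.Iic l)) (h0 : p 0 ∉ K D) (hz : p l ∈ K D) :
    ∃ D' i, Reversal D D' l p i := by
  classical
  obtain ⟨f, hf⟩ : ∃ f, D (p 0) = Sum.inr f := by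
    rcases hD : D (p 0) with f | f
    · exact absurd (by simp [K, hD]) h0
    · exact ⟨f, rfl⟩
  obtain ⟨g, hg⟩ : ∃ g, D (p l) = Sum.inl g := by
    rcases hD : D (p l) with f | f
    · exact ⟨f, rfl⟩
    · simp [K, hD] at hz
  obtain ⟨i, hi⟩ : ∃ i, f i = p 1 := by
    have := hp 0 hl
    unfold heads at this
    rw [hf, Sum.elim_inr, Multiset.mem_map] at this
    exact ⟨this.choose, this.choose_spec.2⟩
  -- The position of a vertex on the walk, well defined because the walk is injective.
  let idx := Function.invFunOn p (Set.Iic l)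
  have hidx : ∀ m ≤ l, idx (p m) = m := fun m hm => hinj.leftInvOn_invFunOn hm
  have hne : ∀ a ≤ l, ∀ b ≤ l, a ≠ b → p a ≠ p b := fun a ha b hb hab h => hab (hinj ha hb h)
  refine ⟨fun v => if v = p 0 then Sum.inl (i.removeNth f) else
    if v = p l then Sum.inr (Fin.cons (α := fun _ => Fin n) (p (l - 1)) g) else
    if ∃ m ≤ l, p m = v then
      mapHeads (fun w => if w = p (idx v + 1) then p (idx v - 1) else w) (D v)
    else D v, i, ?_, ⟨f, hf, hi, ?_⟩, ⟨g, hg, ?_⟩, ?_⟩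
  · intro v hv
    rw [if_neg (hv 0 (Nat.zero_le l)).symm, if_neg (hv l le_rfl).symm, if_neg]
    push Not
    exact hv
  · rw [if_pos rfl]
  · rw [if_neg (hne l le_rfl 0 (Nat.zero_le l) (by omega)), if_pos rfl]
  · intro m hm hml
    rw [if_neg (hne m hml.le 0 (Nat.zero_le l) (by omega)),
      if_neg (hne m hml.le l le_rfl (by omega)), if_pos ⟨m, hml.le, rfl⟩, hidx m hml.le]

theorem heads_mapHeads {D : OutDigraph n} {D' : OutDigraph n} {v : Fin n} {g : Fin n → Fin n}
    (h : D' v = mapHeads g (D v)) : heads D' v = (heads D v).map g := by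
  unfold heads
  rw [h]
  rcases D v with f | f <;> simp [mapHeads]

namespace Reversal

variable {D D' : OutDigraph n} {l : ℕ} {p : ℕ → Fin n} {i : Fin 3}

theorem heads_first (h : Reversal D D' l p i) : heads D (p 0) = p 1 ::ₘ heads D' (p 0) := by
  obtain ⟨f, h1, h2, h3⟩ := h.first
  unfold heads
  rw [h1, h3, Sum.elim_inl, Sum.elim_inr, Fin.univ_succAbove 2 i, Finset.cons_val,
    Multiset.map_cons, h2, Finset.map_val, Multiset.map_map]
  rfl

theorem heads_last (h : Reversal D D' l p i) : heads D' (p l) = p (l - 1) ::ₘ heads D (p l) := by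
  obtain ⟨f, h1, h2⟩ := h.last
  unfold heads
  rw [h1, h2, Sum.elim_inl, Sum.elim_inr, Fin.univ_succ, Finset.cons_val,
    Multiset.map_cons, Finset.map_val, Multiset.map_map]
  rfl

/-- `mapHeads` redirects every occurrence of `p (m + 1)`, so multiplicity one is what makes this the
exchange of a single arc. -/
theorem heads_mid (h : Reversal D D' l p i) {m : ℕ} (hm : 0 < m) (hml : m < l)
    (hc : (heads D (p m)).count (p (m + 1)) = 1) :
    ∃ H, heads D (p m) = p (m + 1) ::ₘ H ∧ heads D' (p m) = p (m - 1) ::ₘ H := by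
  obtain ⟨H, hH⟩ := Multiset.exists_cons_of_mem
    (Multiset.count_pos.1 (by rw [hc]; exact Nat.one_pos))
  refine ⟨H, hH, ?_⟩
  rw [heads_mapHeads (h.mid m hm hml), hH, Multiset.map_cons, if_pos rfl]
  congr 1
  have h1 : p (m + 1) ∉ H := by
    rw [hH, Multiset.count_cons_self] at hc
    exact Multiset.count_eq_zero.1 (by omega)
  conv_rhs => rw [← Multiset.map_id H]
  refine Multiset.map_congr rfl fun w hw => ?_
  rw [if_neg]
  · rfl
  · rintro rfl; exact h1 hw

theorem mem_heads (h : Reversal D D' l p i) (hc : ∀ m < l, (heads D (p m)).count (p (m + 1)) = 1)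
    {m : ℕ} (hm : m < l) : p m ∈ heads D' (p (m + 1)) := by
  rcases Nat.lt_or_ge (m + 1) l with hlt | hge
  · obtain ⟨H, -, h2⟩ := h.heads_mid (Nat.succ_pos m) hlt (hc (m + 1) hlt)
    rw [h2]; exact Multiset.mem_cons_self _ _
  · obtain rfl : l = m + 1 := by omega
    rw [h.heads_last]; exact Multiset.mem_cons_self _ _

theorem follows (h : Reversal D D' l p i) (hc : ∀ m < l, (heads D (p m)).count (p (m + 1)) = 1) :
    Follows D' l (fun j => p (l - j)) := by
  intro j hj
  have := h.mem_heads hc (m := l - (j + 1)) (by omega)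
  rwa [show l - (j + 1) + 1 = l - j by omega] at this

/-- The multisets of heads change along the walk only. -/
theorem heads_add (h : Reversal D D' l p i) (hl : 0 < l) (hinj : Set.InjOn p (Set.Iic l))
    (hc : ∀ m < l, (heads D (p m)).count (p (m + 1)) = 1) (v : Fin n) :
    heads D' v + ∑ m ∈ Finset.range l, (if p m = v then {p (m + 1)} else 0) =
      heads D v + ∑ m ∈ Finset.range l, (if p (m + 1) = v then {p m} else 0) := by
  by_cases hv : ∃ m ≤ l, p m = v
  · obtain ⟨m, hm, rfl⟩ := hv
    have h1 : ∑ j ∈ Finset.range l, (if p j = p m then ({p (j + 1)} : Multiset (Fin n)) else 0) =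
        if m < l then {p (m + 1)} else 0 := by
      have : ∀ j ∈ Finset.range l, (if p j = p m then ({p (j + 1)} : Multiset (Fin n)) else 0) =
          if m = j then {p (j + 1)} else 0 := by
        intro j hj
        rw [Finset.mem_range] at hj
        have : p j = p m ↔ m = j := by rw [hinj.eq_iff (Set.mem_Iic.2 hj.le) hm, eq_comm]
        simp only [this]
      rw [Finset.sum_congr rfl this, Finset.sum_ite_eq]
      simp
    have h2 : ∑ j ∈ Finset.range l, (if p (j + 1) = p m then ({p j} : Multiset (Fin n)) else 0) =
        if 0 < m then {p (m - 1)} else 0 := by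
      have : ∀ j ∈ Finset.range l, (if p (j + 1) = p m then ({p j} : Multiset (Fin n)) else 0) =
          if m - 1 = j then (if 0 < m then {p j} else 0) else 0 := by
        intro j hj
        rw [Finset.mem_range] at hj
        have : p (j + 1) = p m ↔ j + 1 = m := hinj.eq_iff (Set.mem_Iic.2 (by omega)) hm
        simp only [this]
        split_ifs <;> first | rfl | omega
      rw [Finset.sum_congr rfl this, Finset.sum_ite_eq]
      rw [if_pos (Finset.mem_range.2 (by omega))]
    rw [h1, h2]
    rcases Nat.eq_zero_or_pos m with rfl | hm0
    · rw [if_pos hl, if_neg (lt_irrefl 0), h.heads_first, add_zero, add_comm]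
      rfl
    · rw [if_pos hm0]
      rcases hm.lt_or_eq with hlt | rfl
      · rw [if_pos hlt]
        obtain ⟨H, k1, k2⟩ := h.heads_mid hm0 hlt (hc m hlt)
        rw [k1, k2, ← Multiset.singleton_add, ← Multiset.singleton_add]
        abel
      · rw [if_neg (lt_irrefl m), add_zero, h.heads_last, ← Multiset.singleton_add, add_comm]
  · push Not at hv
    have h1 : ∀ m ∈ Finset.range l, (if p m = v then ({p (m + 1)} : Multiset (Fin n)) else 0) = 0 :=
      fun m hm => if_neg (hv m (Finset.mem_range.1 hm).le)
    have h2 : ∀ m ∈ Finset.range l, (if p (m + 1) = v then ({p m} : Multiset (Fin n)) else 0) = 0 :=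
      fun m hm => if_neg (hv (m + 1) (Finset.mem_range.1 hm))
    rw [Finset.sum_congr rfl h1, Finset.sum_congr rfl h2]
    unfold heads
    rw [h.off v hv]

theorem underlying_eq (h : Reversal D D' l p i) (hl : 0 < l) (hinj : Set.InjOn p (Set.Iic l))
    (hc : ∀ m < l, (heads D (p m)).count (p (m + 1)) = 1) : underlying D' = underlying D := by
  have h1 : ∀ v : Fin n,
      (heads D' v).map (fun w => s(v, w)) +
        ∑ m ∈ Finset.range l, (if p m = v then ({s(p m, p (m + 1))} : Multiset (Sym2 (Fin n))) else 0) =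
      (heads D v).map (fun w => s(v, w)) +
        ∑ m ∈ Finset.range l,
          (if p (m + 1) = v then ({s(p m, p (m + 1))} : Multiset (Sym2 (Fin n))) else 0) := by
    intro v
    -- As unordered pairs, the arcs removed and the arcs inserted are the same edges s(p m, p (m +
    -- 1)); summed over all tails they cancel.
    have h2 := congrArg (Multiset.mapAddMonoidHom (fun w => s(v, w))) (h.heads_add hl hinj hc v)
    rw [map_add, map_add, map_sum, map_sum] at h2
    simp only [Multiset.coe_mapAddMonoidHom] at h2
    convert h2 using 3 with m _ m _
    · split_ifs with he
      · subst he; simp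
      · simp
    · split_ifs with he
      · subst he; simp [Sym2.eq_swap]
      · simp
  have h2 := Finset.sum_congr (rfl : (Finset.univ : Finset (Fin n)) = Finset.univ)
    (fun v _ => h1 v)
  rw [Finset.sum_add_distrib, Finset.sum_add_distrib, Finset.sum_comm,
    Finset.sum_comm (s := Finset.univ) (t := Finset.range l)] at h2
  simp only [Finset.sum_ite_eq, Finset.mem_univ, if_true] at h2
  exact add_right_cancel h2

/-- Inner vertices of the walk exchange one in-arc for another, so the change telescopes to the two
ends: the first vertex gains an in-arc and the last one loses one. -/
theorem inDegree_add (h : Reversal D D' l p i) (hl : 0 < l) (hinj : Set.InjOn p (Set.Iic l))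
    (hc : ∀ m < l, (heads D (p m)).count (p (m + 1)) = 1) (v : Fin n) :
    inDegree D' v + (if p l = v then 1 else 0) = inDegree D v + (if p 0 = v then 1 else 0) := by
  have h1 : ∀ u : Fin n,
      (heads D' u).count v +
        ∑ m ∈ Finset.range l, (if p m = u then (if p (m + 1) = v then 1 else 0) else 0) =
      (heads D u).count v +
        ∑ m ∈ Finset.range l, (if p (m + 1) = u then (if p m = v then 1 else 0) else 0) := by
    intro u
    have h2 := congrArg (Multiset.countAddMonoidHom v) (h.heads_add hl hinj hc u)
    rw [map_add, map_add, map_sum, map_sum] at h2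
    simp only [Multiset.coe_countAddMonoidHom] at h2
    convert h2 using 3 with m _ m _
    · split_ifs <;> simp_all [eq_comm]
    · split_ifs <;> simp_all [eq_comm]
  have h2 := Finset.sum_congr (rfl : (Finset.univ : Finset (Fin n)) = Finset.univ)
    (fun v _ => h1 v)
  rw [Finset.sum_add_distrib, Finset.sum_add_distrib, Finset.sum_comm,
    Finset.sum_comm (s := Finset.univ) (t := Finset.range l)] at h2
  simp only [Finset.sum_ite_eq, Finset.mem_univ, if_true] at h2
  have h3 := Finset.sum_range_succ (fun m => if p m = v then 1 else 0) l
  rw [Finset.sum_range_succ'] at h3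
  unfold inDegree
  omega

theorem mem_K_iff (h : Reversal D D' l p i) (v : Fin n) :
    v ∈ K D' ↔ v = p 0 ∨ (v ∈ K D ∧ v ≠ p l) := by
  obtain ⟨f, h1, -, h2⟩ := h.first
  obtain ⟨g, h3, h4⟩ := h.last
  have hne : p 0 ≠ p l := by intro he; rw [he, h3] at h1; simp at h1
  simp only [K, Finset.mem_filter, Finset.mem_univ, true_and]
  by_cases hv0 : v = p 0
  · subst hv0; simp [h2]
  by_cases hvl : v = p l
  · subst hvl; simp [h4, hv0]
  simp only [hv0, false_or, hvl, ne_eq, not_false_eq_true, and_true]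
  by_cases hv : ∃ m ≤ l, p m = v
  · obtain ⟨m, hm, rfl⟩ := hv
    have hm0 : m ≠ 0 := by rintro rfl; exact hv0 rfl
    have hml : m ≠ l := by rintro rfl; exact hvl rfl
    rw [h.mid m (by omega) (by omega)]
    rcases D (p m) with f | f <;> simp [mapHeads]
  · push Not at hv
    rw [h.off v hv]

theorem card_K (h : Reversal D D' l p i) : (K D').card = (K D).card := by
  obtain ⟨f, h1, -, h2⟩ := h.first
  obtain ⟨g, h3, h4⟩ := h.last
  have h5 : K D' = insert (p 0) ((K D).erase (p l)) := by
    ext v; rw [h.mem_K_iff]; simp [and_comm]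
  have h6 : p 0 ∉ K D := by simp [K, h1]
  have h7 : p l ∈ K D := by simp [K, h3]
  rw [h5, Finset.card_insert_of_notMem (fun h => h6 (Finset.mem_of_mem_erase h)),
    Finset.card_erase_of_mem h7]
  have := Finset.card_pos.2 ⟨_, h7⟩
  omega

/-- Only the ends could change status. The first vertex is not in K before and has positive
in-degree afterwards; the last has positive in-degree before and is not in K afterwards. So neither
belongs to L at any time. -/
theorem L_eq (h : Reversal D D' l p i) (hl : 0 < l) (hinj : Set.InjOn p (Set.Iic l))
    (hc : ∀ m < l, (heads D (p m)).count (p (m + 1)) = 1) : L D' = L D := by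
  obtain ⟨f, h1, -, h2⟩ := h.first
  have h6 : p 0 ∉ K D := by simp [K, h1]
  ext v
  have h3 := h.inDegree_add hl hinj hc v
  simp only [L, Finset.mem_filter, h.mem_K_iff]
  have h7 : p 0 = v → v ∉ K D := by rintro rfl; exact h6
  by_cases h8 : p l = v
  · have h9 : p 0 ≠ v := by
      rintro rfl
      have := hinj (Set.mem_Iic.2 le_rfl) (Set.mem_Iic.2 (Nat.zero_le l)) h8
      omega
    simp only [h8, if_true, h9, if_false] at h3
    simp only [h8.symm, ne_eq, not_true_eq_false, and_false, or_false]
    constructor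
    · rintro ⟨h10, -⟩; rw [h8] at h10; exact absurd h10.symm h9
    · rintro ⟨-, h10⟩; rw [h8] at h10; omega
  · by_cases h9 : p 0 = v
    · simp only [h8, h9, if_true, if_false] at h3
      constructor
      · rintro ⟨-, h10⟩; omega
      · rintro ⟨h10, -⟩; exact absurd h10 (h7 h9)
    · simp only [h8, h9, if_false, add_zero] at h3
      simp only [h3, Ne.symm h9, Ne.symm h8, false_or, ne_eq, not_false_eq_true, and_true]

/-- A reversal can be undone once the walk and the index `i` are known. At inner vertices the
substitution of `p (m - 1)` for `p (m + 1)` is invertible because `p (m - 1)` was not a head before;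
at the first vertex the lost head `p 1` is put back at position `i`. -/
theorem eq_of_eq {D₁ D₂ : OutDigraph n} {q : ℕ → Fin n} (h₁ : Reversal D₁ D' l p i)
    (h₂ : Reversal D₂ D' l q i) (hl : 0 < l) (hpq : ∀ m ≤ l, p m = q m)
    (hc₁ : ∀ m, 0 < m → m < l → p (m - 1) ∉ heads D₁ (p m))
    (hc₂ : ∀ m, 0 < m → m < l → q (m - 1) ∉ heads D₂ (q m)) : D₁ = D₂ := by
  have hback : ∀ (D : OutDigraph n) (v a b : Fin n), b ∉ heads D v →
      mapHeads (fun w => if w = b then a else w)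
        (mapHeads (fun w => if w = a then b else w) (D v)) = D v := by
    intro D v a b hb
    rcases hD : D v with f | f
    all_goals
      simp only [mapHeads, Sum.map_inl, Sum.map_inr]
      congr 1
      funext j
      have : f j ≠ b := by
        rintro rfl
        refine hb ?_
        unfold heads
        rw [hD]
        exact Multiset.mem_map.2 ⟨j, Finset.mem_univ_val j, rfl⟩
      by_cases hj : f j = a <;> simp [hj, this]
  funext v
  by_cases hv : ∃ m ≤ l, p m = v
  · obtain ⟨m, hm, rfl⟩ := hv
    rcases Nat.eq_zero_or_pos m with rfl | hm0
    · obtain ⟨f, h1, h2, h3⟩ := h₁.first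
      obtain ⟨g, k1, k2, k3⟩ := h₂.first
      rw [← hpq 0 hm] at k1 k3
      rw [h1, k1]
      rw [h3, Sum.inl.injEq] at k3
      rw [← hpq 1 hl, ← h2] at k2
      congr 1
      rw [← Fin.insertNth_self_removeNth i f, ← Fin.insertNth_self_removeNth i g, k3, k2]
    · rcases hm.lt_or_eq with hlt | rfl
      · have h1 := h₁.mid m hm0 hlt
        have h2 := h₂.mid m hm0 hlt
        have h3 := hc₂ m hm0 hlt
        rw [← hpq m hm, ← hpq (m + 1) hlt, ← hpq (m - 1) (by omega)] at h2
        rw [← hpq m hm, ← hpq (m - 1) (by omega)] at h3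
        rw [← hback D₁ (p m) (p (m + 1)) (p (m - 1)) (hc₁ m hm0 hlt), ← h1, h2, hback _ _ _ _ h3]
      · obtain ⟨f, h1, h2⟩ := h₁.last
        obtain ⟨g, k1, k2⟩ := h₂.last
        rw [← hpq m hm] at k1 k2
        rw [h1, k1]
        rw [h2, Sum.inr.injEq] at k2
        congr 1
        exact (Fin.cons_injective2 k2).2
  · push Not at hv
    rw [← h₁.off v hv, ← h₂.off v (fun m hm => hpq m hm ▸ hv m hm)]

end Reversal

/-! ### The switching inequality. -/

/-- The conditions under which a set of digraphs is closed under the reversal of walks from `x` to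
vertices of `K` outside `I`. -/
def SwitchClosed (𝒟 : Finset (Omega n)) (I : Set (Fin n)) (x : Fin n) : Prop :=
  ∀ D ∈ 𝒟, ∀ D' : Omega n, ∀ z, x ∉ K D.1 → z ∈ K D.1 → z ∉ I → z ∉ L D.1 →
    underlying D'.1 = underlying D.1 → L D'.1 = L D.1 →
    (∀ v, v ∈ K D'.1 ↔ v = x ∨ (v ∈ K D.1 ∧ v ≠ z)) → D' ∈ 𝒟

-- Relate (D, z) to (D', z, i) when D' arises from D by reversing a walk of length ℓ from `x` to
-- `z`, where `i` is the index of the out-arc lost by `x`. Every pair on the left has an image, and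
-- no triple on the right has two preimages; the three values of `i` give the factor 3.
open Classical in
theorem sum_PiToK_le {𝒟 : Finset (Omega n)} {I : Set (Fin n)} {x : Fin n} (hl : 0 < ell n)
    (hx : ∀ D ∈ 𝒟, ¬ Cyclic (underlying D.1) (2 * ell n + 2) x) (hcl : SwitchClosed 𝒟 I x) :
    ∑ D ∈ 𝒟 with x ∉ K D.1, (PiToK D.1 x \ I).ncard ≤
      3 * ∑ D ∈ 𝒟 with x ∈ K D.1, (PiFromV D.1 x).ncard := by
  set l := ell n with hldef
  let A := (𝒟.filter fun D => x ∉ K D.1).sigma fun D => (PiToK D.1 x \ I).toFinset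
  let B := ((𝒟.filter fun D => x ∈ K D.1).sigma fun D => (PiFromV D.1 x).toFinset) ×ˢ
    (Finset.univ : Finset (Fin 3))
  have hA : ∑ D ∈ 𝒟 with x ∉ K D.1, (PiToK D.1 x \ I).ncard = A.card := by
    rw [Finset.card_sigma]
    exact Finset.sum_congr rfl fun D _ => Set.ncard_eq_toFinset_card' _
  have hB : 3 * ∑ D ∈ 𝒟 with x ∈ K D.1, (PiFromV D.1 x).ncard = B.card := by
    rw [Finset.card_product, Finset.card_sigma, Finset.card_univ, Fintype.card_fin, mul_comm]
    congr 1
    exact Finset.sum_congr rfl fun D _ => Set.ncard_eq_toFinset_card' _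
  rw [hA, hB]
  have hmemA : ∀ a ∈ A, a.1 ∈ 𝒟 ∧ x ∉ K a.1.1 ∧ a.2 ∈ K a.1.1 ∧ IsDist a.1.1 l x a.2 ∧ a.2 ∉ I := by
    intro a ha
    simp only [A, Finset.mem_sigma, Finset.mem_filter, Set.mem_toFinset, Set.mem_sdiff] at ha
    exact ⟨ha.1.1, ha.1.2, ha.2.1.1, ha.2.1.2, ha.2.2⟩
  have hcount : ∀ a ∈ A, ∀ p : ℕ → Fin n, p 0 = x → p l = a.2 → Follows a.1.1 l p →
      ∀ m < l, ∀ j ≤ l, (heads a.1.1 (p m)).count (p j) = if j = m + 1 then 1 else 0 := by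
    intro a ha p hp0 hpl hp m hm j hj
    obtain ⟨h1, h2, h3, h4, h5⟩ := hmemA a ha
    refine count_heads_of_isDist ?_ hp ?_ hm hj
    · rw [hp0]; exact hx a.1 h1
    · rw [hp0, hpl]; exact h4
  refine Finset.card_le_card_of_forall_subsingleton
    (fun a b => a.2 = b.1.2 ∧ ∃ p : ℕ → Fin n, p 0 = x ∧ p l = a.2 ∧ Follows a.1.1 l p ∧
      Reversal a.1.1 b.1.1.1 l p b.2) ?_ ?_
  · intro a ha
    obtain ⟨h1, h2, h3, h4, h5⟩ := hmemA a ha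
    obtain ⟨p, hp0, hpl, hp⟩ := hasWalk_iff.1 h4.1
    have hinj : Set.InjOn p (Set.Iic l) := hp.injOn_of_isDist (by rw [hp0, hpl]; exact h4)
    have hc : ∀ m < l, (heads a.1.1 (p m)).count (p (m + 1)) = 1 := fun m hm => by
      rw [hcount a ha p hp0 hpl hp m hm (m + 1) hm, if_pos rfl]
    obtain ⟨D', i, hrev⟩ := exists_reversal hl hp hinj (hp0 ▸ h2) (hpl ▸ h3)
    have hU := hrev.underlying_eq hl hinj hc
    have hK := hrev.mem_K_iff
    have hD' : (⟨D', hrev.card_K.trans a.1.2⟩ : Omega n) ∈ 𝒟 := by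
      refine hcl a.1 h1 _ a.2 h2 h3 h5 ?_ hU (hrev.L_eq hl hinj hc) ?_
      -- `z` is the head of the last arc of the walk, so its in-degree is positive and it is not in
      -- L.
      · intro hL
        have h6 := hrev.inDegree_add hl hinj hc (p l)
        have h7 : inDegree a.1.1 a.2 = 0 := (Finset.mem_filter.1 hL).2
        rw [← hpl] at h7
        have h8 : p 0 ≠ p l := by rw [hp0, hpl]; rintro rfl; exact h2 h3
        rw [if_pos rfl, if_neg h8] at h6
        omega
      · intro v; rw [← hp0, ← hpl]; exact hK v
    -- `x` is still acyclic, as the underlying graph is unchanged. A shorter walk from `z` to `x` in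
    -- D' would therefore have to agree with the reversed walk, which has length `l`.
    have hdist : IsDist D' l a.2 x := by
      have hf := hrev.follows hc
      refine ⟨hasWalk_iff.2 ⟨_, ?_, ?_, hf⟩, ?_⟩
      · simp [hpl]
      · simp [hp0]
      · intro j hj hw
        obtain ⟨q, hq0, hqj, hq⟩ := hasWalk_iff.1 hw
        have hxc : ¬ Cyclic (underlying D') (2 * l + 2) x := by rw [hU]; exact hx a.1 h1
        have := (walk_unique hxc hq hf (by simp [hq0, hpl]) hqj (by simp [hp0]) hj.le le_rfl).1
        omega
    refine ⟨(⟨⟨D', hrev.card_K.trans a.1.2⟩, a.2⟩, i), ?_, rfl, p, hp0, hpl, hp, hrev⟩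
    simp only [B, Finset.mem_product, Finset.mem_sigma, Finset.mem_filter, Set.mem_toFinset,
      Finset.mem_univ, and_true]
    refine ⟨⟨hD', ?_⟩, hdist⟩
    exact (hK x).2 (Or.inl hp0.symm)
  · rintro ⟨⟨D', z⟩, i⟩ hb a ⟨ha, haz, p, hp0, hpl, hp, hrev⟩ a' ⟨ha', haz', q, hq0, hql, hq, hrev'⟩
    simp only [B, Finset.mem_product, Finset.mem_sigma, Finset.mem_filter] at hb
    have hc : ∀ m < l, (heads a.1.1 (p m)).count (p (m + 1)) = 1 := fun m hm => by
      rw [hcount a ha p hp0 hpl hp m hm (m + 1) hm, if_pos rfl]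
    have hc' : ∀ m < l, (heads a'.1.1 (q m)).count (q (m + 1)) = 1 := fun m hm => by
      rw [hcount a' ha' q hq0 hql hq m hm (m + 1) hm, if_pos rfl]
    simp only at haz haz' hrev hrev'
    -- Both reversed walks lead from `z` to `x` in the same D', so they coincide, and with equal `i`
    -- the reversal can be undone.
    have hpq := (walk_unique (hx D' hb.1.1.1) (hrev.follows hc) (hrev'.follows hc')
      (by simp only [Nat.sub_zero]; rw [hpl, hql, haz, haz'])
      (by simp only [Nat.sub_self]; exact hp0)
      (by simp only [Nat.sub_self]; exact hq0) le_rfl le_rfl).2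
    have hpq' : ∀ m ≤ l, p m = q m := by
      intro m hm
      have := hpq (l - m) (by omega)
      simpa only [show l - (l - m) = m by omega] using this
    have hDD : a.1.1 = a'.1.1 := by
      refine hrev.eq_of_eq hrev' hl hpq' ?_ ?_
      · intro m hm hml
        rw [← Multiset.count_eq_zero, hcount a ha p hp0 hpl hp m hml (m - 1) (by omega)]
        exact if_neg (by omega)
      · intro m hm hml
        rw [← Multiset.count_eq_zero, hcount a' ha' q hq0 hql hq m hml (m - 1) (by omega)]
        exact if_neg (by omega)
    obtain ⟨D₁, z₁⟩ := a
    obtain ⟨D₂, z₂⟩ := a'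
    simp only at haz haz' hDD
    obtain rfl : D₁ = D₂ := Subtype.ext hDD
    rw [haz, haz']

/-! ### What determines a part of the partition. -/

theorem graph_congr {ω ω' : Sample n} (h1 : underlying ω.1.1 = underlying ω'.1.1)
    (h2 : A2 ω = A2 ω') {B : Finset (Fin n)} (h3 : ∀ v ∈ B, A3 ω v = A3 ω' v) :
    graph ω B = graph ω' B := by
  unfold graph
  rw [h1, h2]
  congr 1
  unfold arcEdges
  exact Finset.sum_congr rfl fun v hv => by rw [h3 v hv]

/-- A step consults the sample only through the current graph and, in a check, through the third arc
of the vertex being checked. -/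
theorem Step.congr {ω ω' : Sample n} {s s' : State n} (hG : graph ω s.added = graph ω' s.added)
    (hA : ∀ P x o, s.pending = some (P, x :: o) → A3 ω x = A3 ω' x) (h : Step ω s s') :
    Step ω' s s' := by
  cases h with
  | mergeCycles c c' p p' x y hs hF hc hc' hne hp hp' hx hy hxy =>
    exact Step.mergeCycles s c c' p p' x y hs hF hc hc' hne hp hp' hx hy (hG ▸ hxy)
  | absorbCycle P q c p x y hs hP hq hx hc hp hy hxy =>
    exact Step.absorbCycle s P q c p x y hs hP (hG ▸ hq) hx hc hp hy (hG ▸ hxy)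
  | absorbPath P q Q l r x y hs hP hq hx hQ hne hl hxy =>
    exact Step.absorbPath s P q Q l r x y hs hP (hG ▸ hq) hx hQ hne hl (hG ▸ hxy)
  | order P o hs hP hN ho hmem =>
    exact Step.order s P o hs hP (hG ▸ hN) ho (hG ▸ hmem)
  | checkMiss P o x hs hx =>
    have hx' := hA P x o hs
    rw [hx', hG] at hx
    rw [hx']
    exact Step.checkMiss s P o x hs hx
  | checkHit P o q x y hs hx hy hq hqx hqy =>
    rw [hA P x o hs] at hx
    exact Step.checkHit s P o q x y hs hx (hG ▸ hy) (hG ▸ hq) hqx hqy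

theorem Step.checks_prefix {ω : Sample n} {s s' : State n} (h : Step ω s s') :
    s.checks <+: s'.checks := by
  cases h <;> first | exact List.prefix_rfl | exact List.prefix_append _ _

theorem Step.exists_check {ω : Sample n} {s s' : State n} (h : Step ω s s') {P o : List (Fin n)}
    {x : Fin n} (hs : s.pending = some (P, x :: o)) : ∃ a, s'.checks = s.checks ++ [(x, a)] := by
  cases h with
  | checkMiss P' o' x' hs' hx' =>
    rw [hs] at hs'
    simp only [Option.some.injEq, Prod.mk.injEq, List.cons.injEq] at hs'
    exact ⟨_, by rw [hs'.2.1]⟩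
  | checkHit P' o' q x' y hs' hx' hy hq hqx hqy =>
    rw [hs] at hs'
    simp only [Option.some.injEq, Prod.mk.injEq, List.cons.injEq] at hs'
    exact ⟨_, by rw [hs'.2.1]⟩
  | mergeCycles c c' p p' x y hs' => rw [hs] at hs'; cases hs'
  | absorbCycle P q c p x y hs' => rw [hs] at hs'; cases hs'
  | absorbPath P q Q l r x y hs' => rw [hs] at hs'; cases hs'
  | order P o hs' => rw [hs] at hs'; cases hs'

/-- While end-points remain to be checked, the procedure can go on. -/
theorem exists_step_of_pending {ω : Sample n} {s : State n} {P o : List (Fin n)} {x : Fin n}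
    (hs : s.pending = some (P, x :: o)) : ∃ s', Step ω s s' := by
  by_cases h : ∃ y, A3 ω x = some y ∧ y ∈ ENDFrom (graph ω s.added) P.toFinset x
  · obtain ⟨y, hxy, hy⟩ := h
    obtain ⟨q, h1, h2, h3⟩ := hy.2
    exact ⟨_, Step.checkHit s P o q x y hs hxy hy h1 h2 h3⟩
  · push Not at h
    exact ⟨_, Step.checkMiss s P o x hs h⟩

/-- The recorded outcomes are correct, and edges are added only in checks. -/
structure State.Consistent (ω : Sample n) (s : State n) : Prop where
  added : ∀ v ∈ s.added, ∃ a, (v, a) ∈ s.checks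
  outcome : ∀ c ∈ s.checks, c.2 = A3 ω c.1

theorem Step.consistent {ω : Sample n} {s s' : State n} (h : Step ω s s')
    (hs : s.Consistent ω) : s'.Consistent ω := by
  cases h with
  | mergeCycles => exact ⟨hs.added, hs.outcome⟩
  | absorbCycle => exact ⟨hs.added, hs.outcome⟩
  | absorbPath => exact ⟨hs.added, hs.outcome⟩
  | order => exact ⟨hs.added, hs.outcome⟩
  | checkMiss P o x hp hx =>
    refine ⟨fun v hv => ?_, fun c hc => ?_⟩
    · obtain ⟨a, ha⟩ := hs.added v hv
      exact ⟨a, List.mem_append_left _ ha⟩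
    · rcases List.mem_append.1 hc with h | h
      · exact hs.outcome c h
      · rw [List.mem_singleton.1 h]
  | checkHit P o q x y hp hx hy hq hqx hqy =>
    refine ⟨fun v hv => ?_, fun c hc => ?_⟩
    · rcases Finset.mem_insert.1 hv with rfl | hv
      · exact ⟨_, List.mem_append_right _ (List.mem_singleton_self _)⟩
      · obtain ⟨a, ha⟩ := hs.added v hv
        exact ⟨a, List.mem_append_left _ ha⟩
    · rcases List.mem_append.1 hc with h | h
      · exact hs.outcome c h
      · rw [List.mem_singleton.1 h, hx]

namespace Rule

variable (R : Rule n) (ω : Sample n)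

theorem run_succ (t : ℕ) : R.run ω (t + 1) = R.run ω t ∨ Step ω (R.run ω t) (R.run ω (t + 1)) := by
  by_cases h : {s | Step ω (R.run ω t) s}.Nonempty
  · right
    have h1 := R.next_spec (underlying ω.1.1) (A2 ω) (R.run ω t) _ h
    rw [run, if_pos h]
    exact h1
  · left
    rw [run, if_neg h]

theorem step_run_succ {t : ℕ} {s : State n} (h : Step ω (R.run ω t) s) :
    Step ω (R.run ω t) (R.run ω (t + 1)) := by
  have h' : {s | Step ω (R.run ω t) s}.Nonempty := ⟨s, h⟩
  have h1 := R.next_spec (underlying ω.1.1) (A2 ω) (R.run ω t) _ h'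
  rw [run, if_pos h']
  exact h1

theorem checks_prefix_succ (t : ℕ) : (R.run ω t).checks <+: (R.run ω (t + 1)).checks := by
  rcases R.run_succ ω t with h | h
  · rw [h]
  · exact h.checks_prefix

theorem consistent_run (t : ℕ) : (R.run ω t).Consistent ω := by
  induction t with
  | zero => exact ⟨fun v hv => by simp [run] at hv, fun c hc => by simp [run] at hc⟩
  | succ t ih =>
    rcases R.run_succ ω t with h | h
    · rw [h]; exact ih
    · exact h.consistent ih

variable {ω}

theorem take_eq_of_prefix {α : Type*} {a b : List α} {i : ℕ} (h : a <+: b) (hi : i ≤ a.length) :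
    b.take i = a.take i := by
  obtain ⟨c, rfl⟩ := h
  exact List.take_append_of_le_length hi

/-- The part of a sample is determined by `Γ_{D₁}`, `A₂` and the arcs `A₃` of the checked
vertices. -/
theorem filtration_of_agree {i : ℕ} {ω' : Sample n} (h1 : underlying ω.1.1 = underlying ω'.1.1)
    (h2 : A2 ω = A2 ω') (h3 : ∀ v ∈ R.checked i ω, A3 ω v = A3 ω' v) :
    (R.filtration i).r ω ω' := by
  refine ⟨h1, h2, ?_⟩
  -- The two runs coincide until `i` checks have been made; afterwards they may diverge, but the
  -- first `i` checks are fixed.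
  have key : ∀ t, R.run ω t = R.run ω' t ∨
      (i ≤ (R.run ω t).checks.length ∧ i ≤ (R.run ω' t).checks.length ∧
        (R.run ω t).checks.take i = (R.run ω' t).checks.take i) := by
    intro t
    induction t with
    | zero => left; simp only [run, h1, h2]
    | succ t ih =>
      have k1 := R.checks_prefix_succ ω t
      have k2 := R.checks_prefix_succ ω' t
      have later : i ≤ (R.run ω t).checks.length → i ≤ (R.run ω' t).checks.length →
          (R.run ω t).checks.take i = (R.run ω' t).checks.take i →
          R.run ω (t + 1) = R.run ω' (t + 1) ∨
            (i ≤ (R.run ω (t + 1)).checks.length ∧ i ≤ (R.run ω' (t + 1)).checks.length ∧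
              (R.run ω (t + 1)).checks.take i = (R.run ω' (t + 1)).checks.take i) := by
        intro j1 j2 j3
        right
        refine ⟨j1.trans k1.length_le, j2.trans k2.length_le, ?_⟩
        rw [take_eq_of_prefix k1 j1, take_eq_of_prefix k2 j2, j3]
      rcases ih with ih | ⟨j1, j2, j3⟩
      · by_cases hlen : i ≤ (R.run ω t).checks.length
        · exact later hlen (ih ▸ hlen) (by rw [ih])
        · left
          have hG : graph ω (R.run ω t).added = graph ω' (R.run ω t).added := by
            refine graph_congr h1 h2 fun v hv => h3 v ?_
            obtain ⟨a, ha⟩ := (R.consistent_run ω t).added v hv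
            exact ⟨t, a, by rwa [List.take_of_length_le (by omega)]⟩
          have hA : ∀ P x o, (R.run ω t).pending = some (P, x :: o) → A3 ω x = A3 ω' x := by
            intro P x o hp
            -- The first pending vertex is checked in the very next step, and fewer than `i` checks
            -- precede it, so it is among the first `i` and its arc is the same in both samples.
            obtain ⟨s, hs⟩ := exists_step_of_pending (ω := ω) hp
            obtain ⟨a, ha⟩ := (R.step_run_succ ω hs).exists_check hp
            refine h3 x ⟨t + 1, a, ?_⟩
            rw [ha, List.take_of_length_le (by simp; omega)]
            simp
          have hset : {s | Step ω (R.run ω t) s} = {s | Step ω' (R.run ω' t) s} := by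
            rw [← ih]
            ext s
            exact ⟨fun h => h.congr hG hA,
              fun h => h.congr hG.symm fun P x o hp => (hA P x o hp).symm⟩
          rw [run, run, hset, h1, h2, ih]
      · exact later j1 j2 j3
  intro t
  rcases key t with h | h
  · rw [h]
  · exact h.2.2

theorem checked_eq {i : ℕ} {ω' : Sample n} (h : (R.filtration i).r ω ω') :
    R.checked i ω = R.checked i ω' := by
  ext v
  simp only [checked, Set.mem_ofPred_eq, h.2.2]

theorem A3_eq_of_mem_checked {i : ℕ} {ω' : Sample n} (h : (R.filtration i).r ω ω') {v : Fin n}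
    (hv : v ∈ R.checked i ω) : A3 ω v = A3 ω' v := by
  obtain ⟨t, a, hva⟩ := hv
  have h1 := (R.consistent_run ω t).outcome _ (List.mem_of_mem_take hva)
  rw [h.2.2 t] at hva
  have h2 := (R.consistent_run ω' t).outcome _ (List.mem_of_mem_take hva)
  exact h1.symm.trans h2

end Rule

theorem third_ne_none_iff {ω : Sample n} {v : Fin n} : third ω v ≠ none ↔ v ∈ K ω.1.1 := by
  unfold third
  split_ifs with h <;> simp [h]

theorem A3_ne_none_iff {ω : Sample n} {v : Fin n} : A3 ω v ≠ none ↔ v ∈ K ω.1.1 \ L ω.1.1 := by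
  unfold A3
  split_ifs with h
  · simp only [h, iff_true]
    exact third_ne_none_iff.2 (Finset.mem_sdiff.1 h).1
  · simp [h]

/-- Any partial assignment of third arcs to `K(D)` extends to a tuple. -/
theorem exists_third (D : Omega n) (a : Fin n → Option (Fin n)) :
    ∃ A : Fin (k n) → Fin n, ∀ v ∈ K D.1, a v ≠ none → third (D, A) v = a v := by
  classical
  -- Where `a` is undefined any head would do; the vertex itself is used.
  refine ⟨fun j => (a ((K D.1).orderIsoOfFin D.2 j)).getD ((K D.1).orderIsoOfFin D.2 j), ?_⟩
  intro v hv hav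
  unfold third
  simp only
  rw [dif_pos hv]
  simp only [OrderIso.apply_symm_apply]
  obtain ⟨w, hw⟩ := Option.ne_none_iff_exists'.1 hav
  rw [hw]
  rfl

/-- The digraphs that occur in a part are determined by the underlying graph, the set `L`, and the
membership of the checked vertices in `K \ L`. -/
theorem mem_D1_of_agree {R : Rule n} {i : ℕ} {X : Set (Sample n)} (hX : X ∈ (R.filtration i).classes)
    {ω : Sample n} (hω : ω ∈ X) {D D' : Omega n} (hD : D ∈ D1 X)
    (h1 : underlying D'.1 = underlying D.1) (h2 : L D'.1 = L D.1)
    (h3 : ∀ v ∈ R.checked i ω, v ∈ K D'.1 ↔ v ∈ K D.1) : D' ∈ D1 X := by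
  obtain ⟨A, hA⟩ := hD
  obtain ⟨ω₀, rfl⟩ := hX
  have hLK : ∀ E : OutDigraph n, ∀ v ∈ L E, v ∈ K E := fun E v hv => (Finset.mem_filter.1 hv).1
  obtain ⟨A', hA'⟩ := exists_third D' (third (D, A))
  have h4 : (R.filtration i).r (D, A) ω := (R.filtration i).trans' hA ((R.filtration i).symm' hω)
  have h5 : (R.filtration i).r (D, A) (D', A') := by
    refine R.filtration_of_agree h1.symm ?_ ?_
    · funext v
      unfold A2
      simp only [h2]
      split_ifs with h
      · exact (hA' v (hLK _ v (h2 ▸ h)) (third_ne_none_iff.2 (hLK _ v h))).symm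
      · rfl
    · intro v hv
      rw [R.checked_eq h4] at hv
      have h6 := h3 v hv
      unfold A3
      simp only [Finset.mem_sdiff, h2, h6]
      split_ifs with h
      · exact (hA' v (h6.2 h.1) (third_ne_none_iff.2 h.1)).symm
      · rfl
  exact ⟨A', (R.filtration i).trans' ((R.filtration i).symm' h5) hA⟩

/-- A reversal changes K only at `x` and `z`. The vertex `x` is unchecked, and a checked `z` in K \
L would be in I, so no checked vertex changes its status. -/
theorem switchClosed_D1 {R : Rule n} {i : ℕ} {X : Set (Sample n)}
    (hX : X ∈ (R.filtration i).classes) {ω : Sample n} (hω : ω ∈ X) {x : Fin n}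
    (hx : x ∉ R.checked i ω) {𝒟 : Finset (Omega n)} (h𝒟 : ∀ D, D ∈ 𝒟 ↔ D ∈ D1 X) :
    SwitchClosed 𝒟 (R.inSet i ω) x := by
  intro D hD D' z hxD hzD hzI hzL h1 h2 h3
  rw [h𝒟] at hD ⊢
  refine mem_D1_of_agree hX hω hD h1 h2 fun v hv => ?_
  have hvx : v ≠ x := by rintro rfl; exact hx hv
  have hvz : v ≠ z := by
    rintro rfl
    obtain ⟨A, hA⟩ := hD
    obtain ⟨ω₀, rfl⟩ := hX
    have h4 : (R.filtration i).r ω (D, A) := (R.filtration i).trans' hω ((R.filtration i).symm' hA)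
    refine hzI ⟨hv, ?_⟩
    rw [← A3_ne_none_iff, R.A3_eq_of_mem_checked h4 hv, A3_ne_none_iff]
    exact Finset.mem_sdiff.2 ⟨hzD, hzL⟩
  rw [h3]
  simp [hvx, hvz]

theorem inSet_subset_K {R : Rule n} {i : ℕ} {X : Set (Sample n)}
    (hX : X ∈ (R.filtration i).classes) {ω : Sample n} (hω : ω ∈ X) {D : Omega n} (hD : D ∈ D1 X)
    {v : Fin n} (hv : v ∈ R.inSet i ω) : v ∈ K D.1 := by
  obtain ⟨A, hA⟩ := hD
  obtain ⟨ω₀, rfl⟩ := hX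
  have h4 : (R.filtration i).r ω (D, A) := (R.filtration i).trans' hω ((R.filtration i).symm' hA)
  have h5 := A3_ne_none_iff.2 hv.2
  rw [R.A3_eq_of_mem_checked h4 hv.1, A3_ne_none_iff] at h5
  exact (Finset.mem_sdiff.1 h5).1

theorem underlying_eq_of_mem_D1 {R : Rule n} {i : ℕ} {X : Set (Sample n)}
    (hX : X ∈ (R.filtration i).classes) {ω : Sample n} (hω : ω ∈ X) {D : Omega n}
    (hD : D ∈ D1 X) : underlying D.1 = underlying ω.1.1 := by
  obtain ⟨A, hA⟩ := hD
  obtain ⟨ω₀, rfl⟩ := hX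
  have h4 : (R.filtration i).r (D, A) ω := (R.filtration i).trans' hA ((R.filtration i).symm' hω)
  exact h4.1

theorem mem_inSet_of_checked {R : Rule n} {i : ℕ} {ω : Sample n} {x : Fin n}
    (hx : x ∈ R.checked i ω) (hxO : x ∉ R.outSet i ω) : x ∈ R.inSet i ω := by
  simp only [Rule.outSet, Set.mem_ofPred_eq, not_or, not_and, not_not] at hxO
  exact ⟨hx, Finset.mem_sdiff.2 ⟨hxO.2 hx, hxO.1⟩⟩

/-! ### Degree and sparsity outside E_G, inherited by subgraphs. -/

theorem MGraph.degree_mono {G H : MGraph n} (h : H ≤ G) (v : Fin n) : H.degree v ≤ G.degree v :=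
  Nat.add_le_add (Multiset.countP_le_of_le _ h) (Multiset.count_le_of_le _ h)

theorem MGraph.spanned_mono_graph {G H : MGraph n} (h : H ≤ G) (S : Finset (Fin n)) :
    H.spanned S ≤ G.spanned S :=
  Multiset.countP_le_of_le _ h

theorem MGraph.Conn.mono {G H : MGraph n} (h : H ≤ G) {S : Finset (Fin n)} (hS : H.Conn S) :
    G.Conn S := by
  refine SimpleGraph.Connected.mono ?_ hS
  intro u v huv
  simp only [SimpleGraph.comap_adj, Function.Embedding.subtype_apply, MGraph.toSimple,
    SimpleGraph.fromEdgeSet_adj] at huv ⊢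
  exact ⟨Multiset.mem_of_le h huv.1, huv.2⟩

theorem degree_lt_of_notMem_EG {G H : MGraph n} (hG : G ∉ EG n) (h : H ≤ G) (v : Fin n) :
    (H.degree v : ℝ) < Delta0 n := by
  by_contra hcon
  refine hG (Or.inl (Or.inl ⟨v, (not_lt.1 hcon).trans ?_⟩))
  exact_mod_cast MGraph.degree_mono h v

theorem sparse_of_notMem_EG {G H : MGraph n} (hG : G ∉ EG n) (h : H ≤ G) {b : ℕ}
    (hb : (b : ℝ) < 1 / 4 * Real.log n) : Sparse H b := by
  intro U hU hc
  by_contra hcon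
  refine hG (Or.inl (Or.inr ⟨U, 1, le_rfl, by norm_num, ?_, hc.mono h, ?_⟩))
  · have : (U.card : ℝ) ≤ b := by exact_mod_cast hU
    push_cast
    linarith
  · have := MGraph.spanned_mono_graph h U
    omega

theorem underlying_le_currentGraph (R : Rule n) (i : ℕ) (ω : Sample n) :
    underlying ω.1.1 ≤ R.currentGraph i ω := by
  unfold Rule.currentGraph graph
  rw [add_assoc]
  exact Multiset.le_add_right _ _

/-! ### Averaging over the digraphs of a part. -/

/-- Averaging over a family with few exceptional members, then Markov's inequality. -/
theorem markov_card_le {α : Type*} {𝒟 : Finset α} (h𝒟 : 𝒟.Nonempty) (E : α → Prop)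
    [DecidablePred E] (F : Fin n → α → ℝ) (hF : ∀ x D, 0 ≤ F x D) {A B ε θ : ℝ} (hA : 0 ≤ A)
    (hB : 0 ≤ B) (h1 : ∀ D ∈ 𝒟, ¬ E D → ∑ x, F x D ≤ A)
    (h2 : ∀ D ∈ 𝒟, E D → ∑ x, F x D ≤ B)
    (h3 : ((𝒟.filter E).card : ℝ) ≤ ε * 𝒟.card) :
    θ * (({x | θ * 𝒟.card < ∑ D ∈ 𝒟, F x D} : Set (Fin n)).ncard : ℝ) ≤ A + ε * B := by
  classical
  have hN : (0 : ℝ) < 𝒟.card := by exact_mod_cast h𝒟.card_pos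
  set S : Finset (Fin n) := Finset.univ.filter fun x => θ * 𝒟.card < ∑ D ∈ 𝒟, F x D with hS
  have hS' : ({x | θ * 𝒟.card < ∑ D ∈ 𝒟, F x D} : Set (Fin n)).ncard = S.card := by
    rw [← Set.ncard_coe_finset S]; congr 1; ext x; simp [hS]
  rw [hS']
  have k1 : (S.card : ℝ) * (θ * 𝒟.card) ≤ ∑ x ∈ S, ∑ D ∈ 𝒟, F x D := by
    rw [← nsmul_eq_mul]
    exact Finset.card_nsmul_le_sum _ _ _ fun x hx => (Finset.mem_filter.1 hx).2.le
  have k2 : ∑ x ∈ S, ∑ D ∈ 𝒟, F x D ≤ ∑ x, ∑ D ∈ 𝒟, F x D :=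
    Finset.sum_le_univ_sum_of_nonneg fun x => Finset.sum_nonneg fun D _ => hF x D
  have k3 : ∑ D ∈ 𝒟, ∑ x, F x D ≤ ∑ D ∈ 𝒟, (A + if E D then B else 0) := by
    refine Finset.sum_le_sum fun D hD => ?_
    split_ifs with hE
    · linarith [h2 D hD hE]
    · linarith [h1 D hD hE]
  rw [Finset.sum_add_distrib, ← Finset.sum_filter, Finset.sum_const, Finset.sum_const,
    nsmul_eq_mul, nsmul_eq_mul] at k3
  rw [Finset.sum_comm (s := Finset.univ) (t := 𝒟)] at k2
  have k4 : ((𝒟.filter E).card : ℝ) * B ≤ ε * 𝒟.card * B := mul_le_mul_of_nonneg_right h3 hB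
  have k5 : (θ * S.card) * 𝒟.card ≤ (A + ε * B) * 𝒟.card := by nlinarith
  exact le_of_mul_le_mul_right k5 hN

/-- The lower bound for the frequency of `P` that results from a switching inequality. -/
theorem lt_frequency_of_switching {α : Type*} {𝒟 : Finset α} (h𝒟 : 𝒟.Nonempty) (P : α → Prop)
    [DecidablePred P] (a b c : α → ℝ) {πo πi : ℝ} (ha : ∀ D, 0 ≤ a D) (hb : ∀ D, 0 ≤ b D)
    (ho : 0 < πo) (hoi : 100 * πo ≤ πi)
    (hs : ∑ D ∈ 𝒟 with ¬ P D, (a D - b D) ≤ 3 * ∑ D ∈ 𝒟 with P D, c D)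
    (h1 : ∑ D ∈ 𝒟, (if a D ≤ πo then (1 : ℝ) else 0) ≤ 1 / 16 * 𝒟.card)
    (h2 : ∑ D ∈ 𝒟, b D ≤ πo / 16 * 𝒟.card)
    (h3 : ∑ D ∈ 𝒟, (if πi ≤ c D then c D else 0) ≤ πo / 48 * 𝒟.card) (hc : ∀ D, 0 ≤ c D) :
    πo / (4 * πi) < ((𝒟.filter P).card : ℝ) / 𝒟.card := by
  have hN : (0 : ℝ) < 𝒟.card := by exact_mod_cast h𝒟.card_pos
  have hi : 0 < πi := by linarith
  have e1 : ((𝒟.filter fun D => ¬ P D).card : ℝ) = 𝒟.card - (𝒟.filter P).card := by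
    rw [← Finset.card_filter_add_card_filter_not (s := 𝒟) P]
    push_cast; ring
  have k1 : ∑ D ∈ 𝒟 with ¬ P D, (πo - πo * (if a D ≤ πo then (1 : ℝ) else 0)) ≤
      ∑ D ∈ 𝒟 with ¬ P D, a D := by
    refine Finset.sum_le_sum fun D _ => ?_
    split_ifs with h
    · linarith [ha D]
    · linarith
  have k2 : ∑ D ∈ 𝒟 with ¬ P D, (if a D ≤ πo then (1 : ℝ) else 0) ≤
      ∑ D ∈ 𝒟, (if a D ≤ πo then (1 : ℝ) else 0) :=
    Finset.sum_le_sum_of_subset_of_nonneg (Finset.filter_subset _ _)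
      fun D _ _ => by split_ifs <;> norm_num
  have k3 : ∑ D ∈ 𝒟 with ¬ P D, b D ≤ ∑ D ∈ 𝒟, b D :=
    Finset.sum_le_sum_of_subset_of_nonneg (Finset.filter_subset _ _) fun D _ _ => hb D
  have k4 : ∑ D ∈ 𝒟 with P D, c D ≤
      ∑ D ∈ 𝒟 with P D, (πi + if πi ≤ c D then c D else 0) := by
    refine Finset.sum_le_sum fun D _ => ?_
    split_ifs with h
    · linarith
    · linarith
  have k5 : ∑ D ∈ 𝒟 with P D, (if πi ≤ c D then c D else 0) ≤
      ∑ D ∈ 𝒟, (if πi ≤ c D then c D else 0) :=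
    Finset.sum_le_sum_of_subset_of_nonneg (Finset.filter_subset _ _)
      fun D _ _ => by split_ifs <;> simp [hc D]
  rw [Finset.sum_sub_distrib] at hs k1
  rw [← Finset.mul_sum, Finset.sum_const, nsmul_eq_mul, e1] at k1
  rw [Finset.sum_add_distrib, Finset.sum_const, nsmul_eq_mul] at k4
  have k6 := mul_le_mul_of_nonneg_left (k2.trans h1) ho.le
  set M : ℝ := ((𝒟.filter P).card : ℝ)
  set N : ℝ := (𝒟.card : ℝ)
  have hM : 0 ≤ M := Nat.cast_nonneg _
  -- Each of the three error terms costs at most πo N / 16, the last one after the factor 3. Since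
  -- (13/16) / 3.01 > 1/4, the claim follows.
  have k7 : (13 / 16) * (πo * N) ≤ M * (πo + 3 * πi) := by nlinarith
  have k8 : M * (πo + 3 * πi) ≤ M * (3.01 * πi) := by
    refine mul_le_mul_of_nonneg_left ?_ hM
    linarith
  rw [div_lt_div_iff₀ (by linarith) hN]
  have : 0 < πo * N := mul_pos ho hN
  nlinarith

section Counts

open Classical in
-- Double counting of the pairs (x, z) with z ∈ I at distance ℓ from x.
theorem sum_ncard_inter_le (D : OutDigraph n) (I : Set (Fin n)) :
    ∑ x, ((PiToK D x ∩ I).ncard : ℝ) ≤ ∑ z ∈ I.toFinset, ((PiFromV D z).ncard : ℝ) := by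
  have h1 : ∀ x, (PiToK D x ∩ I).ncard =
      ∑ z ∈ I.toFinset, if z ∈ PiToK D x then 1 else 0 := by
    intro x
    rw [← Finset.card_filter, ← Set.ncard_coe_finset]
    congr 1; ext z; simp [and_comm]
  have h2 : ∀ z, (PiFromV D z).ncard = ∑ x : Fin n, if x ∈ PiFromV D z then 1 else 0 := by
    intro z
    rw [← Finset.card_filter, ← Set.ncard_coe_finset]
    congr 1; ext z; simp
  have h3 : ∑ x, (PiToK D x ∩ I).ncard ≤ ∑ z ∈ I.toFinset, (PiFromV D z).ncard := by
    rw [Finset.sum_congr rfl fun x _ => h1 x, Finset.sum_comm]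
    refine Finset.sum_le_sum fun z _ => ?_
    rw [h2 z]
    refine Finset.sum_le_sum fun x _ => ?_
    by_cases hx : z ∈ PiToK D x
    · rw [if_pos hx, if_pos (show x ∈ PiFromV D z from hx.2)]
    · rw [if_neg hx]; exact Nat.zero_le _
  exact_mod_cast h3

theorem ncard_le (S : Set (Fin n)) : (S.ncard : ℝ) ≤ n := by
  have : S.ncard ≤ n := by
    simpa using Set.ncard_le_ncard (Set.subset_univ S)
  exact_mod_cast this

variable {D : Omega n} (hD : D ∉ ED n)

include hD in
theorem ncard_small_out_le :
    ∑ x, (if ((PiToK D.1 x).ncard : ℝ) ≤ piOut n then (1 : ℝ) else 0) ≤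
      (n : ℝ) / Real.log n ^ 100 := by
  classical
  have h1 : ¬ (n : ℝ) / Real.log n ^ 100 ≤
      (({x | ((PiToK D.1 x).ncard : ℝ) ≤ piOut n} : Set (Fin n)).ncard : ℝ) :=
    fun h => hD (Or.inl h)
  refine le_trans (le_of_eq ?_) (not_le.1 h1).le
  rw [Finset.sum_boole, ← Set.ncard_coe_finset]
  congr 2; ext x; simp

include hD in
theorem sum_large_in_le (hρ : 0 ≤ rhoIn n) :
    ∑ x, (if piIn n ≤ ((PiFromV D.1 x).ncard : ℝ) then ((PiFromV D.1 x).ncard : ℝ) else 0) ≤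
      10 * (n : ℝ) / Real.log n ^ 100 * rhoIn n := by
  classical
  have h1 : ¬ 10 * (n : ℝ) / Real.log n ^ 100 ≤
      (({x | piIn n ≤ ((PiFromV D.1 x).ncard : ℝ)} : Set (Fin n)).ncard : ℝ) :=
    fun h => hD (Or.inr (Or.inl h))
  have h2 : ∀ x, ((PiFromV D.1 x).ncard : ℝ) ≤ rhoIn n := by
    intro x
    by_contra hcon
    exact hD (Or.inr (Or.inr ⟨x, (not_le.1 hcon).le⟩))
  calc ∑ x, (if piIn n ≤ ((PiFromV D.1 x).ncard : ℝ) then ((PiFromV D.1 x).ncard : ℝ) else 0)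
      ≤ ∑ x, (if piIn n ≤ ((PiFromV D.1 x).ncard : ℝ) then (1 : ℝ) else 0) * rhoIn n := by
        refine Finset.sum_le_sum fun x _ => ?_
        split_ifs
        · rw [one_mul]; exact h2 x
        · rw [zero_mul]
    _ = (({x | piIn n ≤ ((PiFromV D.1 x).ncard : ℝ)} : Set (Fin n)).ncard : ℝ) * rhoIn n := by
        rw [← Finset.sum_mul, Finset.sum_boole, ← Set.ncard_coe_finset]
        congr 3; ext x; simp
    _ ≤ _ := mul_le_mul_of_nonneg_right (not_le.1 h1).le hρ

include hD in
theorem sum_inter_le (hρ : 0 ≤ rhoIn n) (hπ : 0 ≤ piIn n) (I : Set (Fin n)) :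
    ∑ x, ((PiToK D.1 x ∩ I).ncard : ℝ) ≤
      I.ncard * piIn n + 10 * (n : ℝ) / Real.log n ^ 100 * rhoIn n := by
  classical
  refine (sum_ncard_inter_le D.1 I).trans ?_
  calc ∑ z ∈ I.toFinset, ((PiFromV D.1 z).ncard : ℝ)
      ≤ ∑ z ∈ I.toFinset, (piIn n +
          if piIn n ≤ ((PiFromV D.1 z).ncard : ℝ) then ((PiFromV D.1 z).ncard : ℝ) else 0) := by
        refine Finset.sum_le_sum fun z _ => ?_
        split_ifs with h
        · linarith
        · linarith
    _ ≤ _ := by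
        rw [Finset.sum_add_distrib, Finset.sum_const, nsmul_eq_mul, Set.ncard_eq_toFinset_card']
        refine add_le_add le_rfl (le_trans ?_ (sum_large_in_le hD hρ))
        exact Finset.sum_le_univ_sum_of_nonneg fun x => by split_ifs <;> simp

end Counts

/-! ### Numerical estimates for large n. -/

/-- The lower bound on `n` that the estimates need. -/
structure Large (n : ℕ) : Prop where
  loglog : 100 ≤ Real.log (Real.log n)
  sqrt_log : 10 ^ 9 * Real.log (Real.log n) ^ 4 ≤ √(Real.log n)

theorem eventually_large : ∀ᶠ n : ℕ in atTop, Large n := by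
  have h1 : Tendsto (fun n : ℕ => Real.log n) atTop atTop :=
    Real.tendsto_log_atTop.comp tendsto_natCast_atTop_atTop
  have h2 : Tendsto (fun n : ℕ => Real.log (Real.log n)) atTop atTop :=
    Real.tendsto_log_atTop.comp h1
  have h3 : Tendsto (fun n : ℕ => √(Real.log n)) atTop atTop := Real.tendsto_sqrt_atTop.comp h1
  -- Apply log⁴ s = o(s) to s = √(log n); since log s is half of log log n, its fourth power brings
  -- the factor 16.
  have h4 := ((Real.isLittleO_pow_log_id_atTop (n := 4)).comp_tendsto h3).bound
    (c := 1 / (16 * 10 ^ 9)) (by norm_num)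
  filter_upwards [h2.eventually_ge_atTop 100, h4, h1.eventually_ge_atTop 1] with n k1 k2 k3
  refine ⟨k1, ?_⟩
  simp only [Function.comp_apply, id_eq, Real.norm_eq_abs] at k2
  rw [Real.log_sqrt (by linarith), abs_of_nonneg (by positivity),
    abs_of_nonneg (Real.sqrt_nonneg _), div_pow] at k2
  linarith

namespace Large

variable (h : Large n)

include h

theorem one_le_sqrt : 1 ≤ √(Real.log n) := by
  refine le_trans ?_ h.sqrt_log
  have : (1 : ℝ) ≤ Real.log (Real.log n) ^ 4 := one_le_pow₀ (by linarith [h.loglog])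
  linarith

theorem log_pos : 0 < Real.log n := by
  rcases (Real.log_natCast_nonneg n).lt_or_eq with h1 | h1
  · exact h1
  · have := h.loglog
    rw [← h1, Real.log_zero] at this
    norm_num at this

theorem exp_log : Real.exp (Real.log n) = n := by
  apply Real.exp_log
  rcases Nat.eq_zero_or_pos n with rfl | h1
  · have := h.log_pos
    simp at this
  · exact_mod_cast h1

theorem exp_loglog : Real.exp (Real.log (Real.log n)) = Real.log n := Real.exp_log h.log_pos

theorem sq_sqrt_log : √(Real.log n) ^ 2 = Real.log n := Real.sq_sqrt h.log_pos.le

theorem sqrt_le_log : √(Real.log n) ≤ Real.log n := by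
  have h1 := h.sq_sqrt_log
  have h2 := h.sqrt_log
  have h3 : (1 : ℝ) ≤ Real.log (Real.log n) ^ 4 := one_le_pow₀ (by linarith [h.loglog])
  nlinarith

theorem mul_pow_le_log : 10 ^ 9 * Real.log (Real.log n) ^ 4 ≤ Real.log n :=
  h.sqrt_log.trans h.sqrt_le_log

theorem mul_sq_le_log : 10 ^ 9 * Real.log (Real.log n) ^ 2 ≤ Real.log n := by
  refine le_trans ?_ h.mul_pow_le_log
  have : Real.log (Real.log n) ^ 2 ≤ Real.log (Real.log n) ^ 4 :=
    pow_le_pow_right₀ (by linarith [h.loglog]) (by norm_num)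
  linarith

theorem mul_le_log : 10 ^ 9 * Real.log (Real.log n) ≤ Real.log n := by
  refine le_trans ?_ h.mul_sq_le_log
  nlinarith [h.loglog]

theorem log_le : Real.log n ≤ n := by
  conv_rhs => rw [← h.exp_log]
  linarith [Real.add_one_le_exp (Real.log n)]

theorem cast_pos : (0 : ℝ) < n := h.log_pos.trans_le h.log_le

theorem ell_le : (ell n : ℝ) ≤ 16 * Real.log (Real.log n) := by
  have h0 := h.loglog
  have h1 := h.one_le_sqrt
  have h2 : 2 ≤ tau n := by
    unfold tau
    have : 1 / √(Real.log n) ≤ 1 := by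
      rw [div_le_one (by linarith)]; exact h1
    linarith
  have h3 : 0.69 ≤ Real.log (tau n) :=
    (by linarith [Real.log_two_gt_d9] : (0.69 : ℝ) ≤ Real.log 2).trans
      (Real.log_le_log (by norm_num) h2)
  have h4 : 10 * Real.logb (tau n) (Real.log n) ≤ 15 * Real.log (Real.log n) := by
    unfold Real.logb
    rw [mul_div_assoc', div_le_iff₀ (by linarith)]
    nlinarith
  have h5 : 0 ≤ 10 * Real.logb (tau n) (Real.log n) := by
    unfold Real.logb
    have : 0 ≤ Real.log (Real.log n) / Real.log (tau n) := div_nonneg (by linarith) (by linarith)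
    linarith
  have h6 := Nat.ceil_lt_add_one h5
  unfold ell
  linarith

theorem ell_pos : 0 < ell n := by
  have h0 := h.loglog
  have h2 : 1 < tau n := by
    unfold tau
    have h1 := h.one_le_sqrt
    have : 1 / √(Real.log n) ≤ 1 := by
      rw [div_le_one (by linarith)]; exact h1
    linarith
  unfold ell Real.logb
  rw [Nat.ceil_pos]
  have : 0 < Real.log (Real.log n) / Real.log (tau n) :=
    div_pos (by linarith) (Real.log_pos h2)
  linarith

/-- Few vertices of a graph outside `E_G` are near short cycles. -/
theorem ncard_cyclic_le {G : MGraph n} (hG : G ∉ EG n) {D : OutDigraph n} (hD : underlying D ≤ G) :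
    (({x | Cyclic (underlying D) (2 * ell n + 2) x} : Set (Fin n)).ncard : ℝ) ≤
      n / Real.log (Real.log n) := by
  have h0 := h.loglog
  have h1 := h.mul_sq_le_log
  have h2 := h.mul_le_log
  have hell := h.ell_le
  set ll := Real.log (Real.log n) with hll
  set lg := Real.log n with hlg
  -- With r of order log log n, t about log n / 40 and d at most 2 log n, the set size `2 * r + 3 *
  -- (t + 1)` stays below log n / 4, and 2^t far exceeds (d + 1)^(2r) = exp(O((log log n)²)).
  set r := 2 * ell n + 2 with hr
  set t := ⌊lg / 40⌋₊ with ht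
  set d := ⌊2 * lg⌋₊ with hd
  have hrr : (r : ℝ) ≤ 32 * ll + 2 := by rw [hr]; push_cast; linarith
  have htt : (t : ℝ) ≤ lg / 40 := Nat.floor_le (by linarith)
  have htt' : lg / 40 < t + 1 := Nat.lt_floor_add_one _
  have hdd : (d : ℝ) ≤ 2 * lg := Nat.floor_le (by linarith)
  have hsparse : Sparse (underlying D) (2 * r + 3 * (t + 1)) := by
    refine sparse_of_notMem_EG hG hD ?_
    push_cast
    linarith
  have hdeg : ∀ v, (underlying D).degree v ≤ d := by
    intro v
    refine Nat.le_floor ((degree_lt_of_notMem_EG hG hD v).le.trans ?_)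
    unfold Delta0
    rw [div_le_iff₀ (by linarith)]
    nlinarith
  have h3 := card_cyclic_mul_le hsparse le_rfl hdeg
  set c := ({x | Cyclic (underlying D) r x} : Set (Fin n)).ncard
  have h4 : (c : ℝ) * 2 ^ t ≤ n * (d + 1) ^ (2 * r) := by exact_mod_cast h3
  have h5 : ((d : ℝ) + 1) ^ (2 * r) ≤ Real.exp (130 * ll ^ 2) := by
    have k1 : (d : ℝ) + 1 ≤ Real.exp (2 * ll) := by
      rw [two_mul, Real.exp_add, h.exp_loglog]
      nlinarith
    calc ((d : ℝ) + 1) ^ (2 * r) ≤ Real.exp (2 * ll) ^ (2 * r) :=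
          pow_le_pow_left₀ (by positivity) k1 _
      _ = Real.exp ((2 * r : ℕ) * (2 * ll)) := (Real.exp_nat_mul _ _).symm
      _ ≤ Real.exp (130 * ll ^ 2) := by
          rw [Real.exp_le_exp]; push_cast; nlinarith
  have h6 : Real.exp (0.69 * (lg / 40 - 1)) ≤ 2 ^ t := by
    have : (2 : ℝ) ^ t = Real.exp (t * Real.log 2) := by
      rw [Real.exp_nat_mul, Real.exp_log (by norm_num)]
    rw [this, Real.exp_le_exp]
    have := Real.log_two_gt_d9
    nlinarith
  have h7 : ll * Real.exp (130 * ll ^ 2) ≤ Real.exp (0.69 * (lg / 40 - 1)) := by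
    have k1 : ll ≤ Real.exp ll := by linarith [Real.add_one_le_exp ll]
    calc ll * Real.exp (130 * ll ^ 2) ≤ Real.exp ll * Real.exp (130 * ll ^ 2) := by gcongr
      _ = Real.exp (ll + 130 * ll ^ 2) := (Real.exp_add _ _).symm
      _ ≤ _ := by rw [Real.exp_le_exp]; nlinarith
  rw [le_div_iff₀ (by linarith)]
  have hn := h.cast_pos
  have h8 : (c : ℝ) * ll * Real.exp (130 * ll ^ 2) ≤ n * Real.exp (130 * ll ^ 2) := by
    calc (c : ℝ) * ll * Real.exp (130 * ll ^ 2) = c * (ll * Real.exp (130 * ll ^ 2)) := by ring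
      _ ≤ c * 2 ^ t := by gcongr; exact h7.trans h6
      _ ≤ n * (d + 1) ^ (2 * r) := h4
      _ ≤ n * Real.exp (130 * ll ^ 2) := by gcongr
  exact le_of_mul_le_mul_right h8 (Real.exp_pos _)

/-- The total contribution of E_D to an average: its relative size times the trivial bound n² for a
sum over all x of terms at most n. -/
theorem exceptional_mul_le : (n : ℝ) ^ 2 * Real.exp (-(Real.log n) ^ 2) * (n : ℝ) ^ 2 ≤ 1 := by
  have h2 := h.mul_le_log
  have h0 := h.loglog
  have h1 : (n : ℝ) ^ 2 = Real.exp (2 * Real.log n) := by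
    conv_lhs => rw [← h.exp_log]
    rw [← Real.exp_nat_mul]; norm_num
  rw [h1, ← Real.exp_add, ← Real.exp_add, Real.exp_le_one_iff]
  nlinarith

theorem k_div_le_one : (k n : ℝ) / n ≤ 1 := by
  rw [div_le_one h.cast_pos]
  have h0 := h.loglog
  have h1 : 2 ≤ √(Real.log n) := by
    refine le_trans ?_ h.sqrt_log
    have : (1 : ℝ) ≤ Real.log (Real.log n) ^ 4 := one_le_pow₀ (by linarith)
    linarith
  have hn := h.cast_pos
  have h2 : (n : ℝ) / √(Real.log n) ≤ n / 2 := by gcongr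
  have h3 : (0 : ℝ) ≤ (n : ℝ) / √(Real.log n) := by positivity
  have h4 := Nat.ceil_lt_add_one h3
  have h5 := h.log_le
  have h6 := h.mul_le_log
  unfold k
  linarith

theorem piOut_ge : √(Real.log n) ^ 19 / Real.log (Real.log n) ^ 2 ≤ piOut n := by
  have hn := h.cast_pos
  have h0 := h.loglog
  have h1 : (1 : ℝ) / √(Real.log n) ≤ (k n : ℝ) / n := by
    rw [le_div_iff₀ hn, div_mul_eq_mul_div, one_mul]
    exact Nat.le_ceil _
  have hy : 0 < √(Real.log n) := Real.sqrt_pos.2 h.log_pos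
  unfold piOut
  calc √(Real.log n) ^ 19 / Real.log (Real.log n) ^ 2
      = (√(Real.log n) ^ 2) ^ 10 / Real.log (Real.log n) ^ 2 * (1 / √(Real.log n)) := by
        field_simp
    _ = Real.log n ^ 10 / Real.log (Real.log n) ^ 2 * (1 / √(Real.log n)) := by
        rw [h.sq_sqrt_log]
    _ ≤ _ := by
        have := h.log_pos
        gcongr

theorem piIn_pos : 0 < piIn n := by
  have h0 := h.loglog
  have h1 := h.log_pos
  unfold piIn
  positivity

theorem rhoIn_nonneg : 0 ≤ rhoIn n := pow_nonneg h.log_pos.le _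

theorem piOut_pos : 0 < piOut n := by
  have h0 := h.loglog
  have hy : 0 < √(Real.log n) := Real.sqrt_pos.2 h.log_pos
  exact lt_of_lt_of_le (by positivity) h.piOut_ge

theorem piOut_le : 100 * piOut n ≤ piIn n := by
  have h0 := h.loglog
  have h1 := h.log_pos
  have h2 : piOut n ≤ Real.log n ^ 10 := by
    unfold piOut
    calc Real.log n ^ 10 / Real.log (Real.log n) ^ 2 * ((k n : ℝ) / n)
        ≤ Real.log n ^ 10 / 1 * 1 := by
          gcongr
          · nlinarith
          · exact h.k_div_le_one
      _ = Real.log n ^ 10 := by ring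
  have h3 : 0 < Real.log n ^ 10 := by positivity
  unfold piIn
  nlinarith

theorem threshold_eq : (k n : ℝ) / n * (1 / (4000 * Real.log (Real.log n) ^ 3)) =
    piOut n / (4 * piIn n) := by
  have h0 := h.loglog
  have h1 := h.log_pos
  have h2 := h.cast_pos
  have : 0 < Real.log (Real.log n) := by linarith
  unfold piOut piIn
  field_simp
  ring

theorem large_in_le : 10 * (n : ℝ) / Real.log n ^ 100 * rhoIn n ≤ n := by
  have h0 := h.loglog
  have h1 := h.log_pos
  have h2 := h.mul_le_log
  have hn := h.cast_pos
  unfold rhoIn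
  have h3 : 10 * (n : ℝ) / Real.log n ^ 100 * Real.log n ^ 20 = 10 * n / Real.log n ^ 80 := by
    field_simp
  rw [h3, div_le_iff₀ (by positivity)]
  have h4 : Real.log n ≤ Real.log n ^ 80 := le_self_pow₀ (by linarith) (by norm_num)
  nlinarith

theorem le_of_markov_out {s : ℝ} (hs : 1 / 16 * s ≤ n / Real.log n ^ 100 + 1) :
    s ≤ n / Real.log (Real.log n) := by
  have h0 := h.loglog
  have hlg := h.log_pos
  have hpos := h.cast_pos
  have hmul := h.mul_le_log
  have hle := h.log_le
  have h2 : (n : ℝ) / Real.log n ^ 100 ≤ n / (32 * Real.log (Real.log n)) := by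
    gcongr
    refine le_trans (by linarith) (le_self_pow₀ (by linarith) (by norm_num))
  have h3 : (1 : ℝ) ≤ n / (32 * Real.log (Real.log n)) := by
    rw [le_div_iff₀ (by linarith)]; linarith
  have h4 : (n : ℝ) / Real.log (Real.log n) = 32 * (n / (32 * Real.log (Real.log n))) := by
    field_simp
  rw [h4]
  linarith

/-- In terms of y = √(log n), the numerator is O(n y¹⁸ log log n), while π_out is at least y¹⁹ /
(log log n)². The ratio is O(n (log log n)³ / y), and the fourth power of log log n in
`Large.sqrt_log` absorbs it. -/
theorem le_of_markov_inter {s q : ℝ} (hs0 : 0 ≤ s) (hq : q ≤ 1200 * (n : ℝ) / Real.log n)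
    (hs : piOut n / 16 * s ≤ q * piIn n + 10 * (n : ℝ) / Real.log n ^ 100 * rhoIn n + 1) :
    s ≤ n / Real.log (Real.log n) := by
  have h0 := h.loglog
  have hlg := h.log_pos
  have hpos := h.cast_pos
  have hle := h.log_le
  have hmul := h.mul_le_log
  have hπ := h.piIn_pos
  have hy2 := h.sq_sqrt_log
  have hyl := h.sqrt_log
  have hy1 := h.one_le_sqrt
  have hlarge := h.large_in_le
  have h2 : q * piIn n ≤
      1200000 * (n * (Real.log (Real.log n) * √(Real.log n) ^ 18)) := by
    calc q * piIn n ≤ 1200 * (n : ℝ) / Real.log n * piIn n := by gcongr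
      _ = 1200000 * (n * (Real.log (Real.log n) * Real.log n ^ 9)) := by
          unfold piIn; field_simp; ring
      _ = 1200000 * (n * (Real.log (Real.log n) * (√(Real.log n) ^ 2) ^ 9)) := by rw [hy2]
      _ = _ := by rw [← pow_mul]
  have hpo := h.piOut_ge
  set y := √(Real.log n)
  set ll := Real.log (Real.log n)
  have h3 : (1 : ℝ) ≤ ll * y ^ 18 :=
    (by linarith : (1 : ℝ) ≤ ll).trans (le_mul_of_one_le_right (by linarith) (one_le_pow₀ hy1))
  have h4 : (n : ℝ) ≤ n * (ll * y ^ 18) := le_mul_of_one_le_right hpos.le h3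
  -- The constant is generous: 16 (1200000 + 1 + 1) < 10⁸.
  have h5 : piOut n * s ≤ 10 ^ 8 * (n * (ll * y ^ 18)) := by linarith
  have h6 := (mul_le_mul_of_nonneg_right hpo hs0).trans h5
  rw [div_mul_eq_mul_div, div_le_iff₀ (by positivity)] at h6
  have h7 : s * y ≤ 10 ^ 8 * n * ll ^ 3 := by
    refine le_of_mul_le_mul_right ?_ (pow_pos (by linarith : 0 < y) 18)
    calc s * y * y ^ 18 = y ^ 19 * s := by ring
      _ ≤ _ := h6
      _ = _ := by ring
  have h8 : s * (10 ^ 9 * ll ^ 4) ≤ 10 ^ 8 * n * ll ^ 3 :=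
    (mul_le_mul_of_nonneg_left hyl hs0).trans h7
  rw [le_div_iff₀ (by linarith)]
  have h9 : (0 : ℝ) < ll ^ 3 := by positivity
  refine le_of_mul_le_mul_right ?_ h9
  have h10 : 0 < (n : ℝ) * ll ^ 3 := by positivity
  linarith

theorem le_of_markov_in {s : ℝ} (hs0 : 0 ≤ s)
    (hs : piOut n / 48 * s ≤ 10 * (n : ℝ) / Real.log n ^ 100 * rhoIn n + 1) :
    s ≤ n / Real.log (Real.log n) := by
  have h0 := h.loglog
  have hle := h.log_le
  have hmul := h.mul_le_log
  have hlarge := h.large_in_le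
  have h2 : 96 * Real.log (Real.log n) ≤ piOut n := by
    refine le_trans ?_ h.piOut_ge
    rw [le_div_iff₀ (by positivity)]
    have h3 : √(Real.log n) ≤ √(Real.log n) ^ 19 := le_self_pow₀ h.one_le_sqrt (by norm_num)
    have h4 : Real.log (Real.log n) ^ 3 ≤ Real.log (Real.log n) ^ 4 :=
      pow_le_pow_right₀ (by linarith) (by norm_num)
    have h5 : 0 < Real.log (Real.log n) ^ 3 := by positivity
    have h6 := h.sqrt_log
    calc 96 * Real.log (Real.log n) * Real.log (Real.log n) ^ 2
        = 96 * Real.log (Real.log n) ^ 3 := by ring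
      _ ≤ √(Real.log n) ^ 19 := by linarith
  rw [le_div_iff₀ (by linarith)]
  have h3 := mul_le_mul_of_nonneg_right h2 hs0
  linarith

end Large

/-! ### Assembly of the bound. -/

theorem ncard_low_probK_le (hn : Large n) {R : Rule n} {i : ℕ} {X : Set (Sample n)}
    (hX : X ∈ (R.filtration i).classes) {ω : Sample n} (hω : ω ∈ X)
    (hG : R.currentGraph i ω ∉ EG n)
    (hED : ((ED n ∩ D1 X).ncard : ℝ) <
      (n : ℝ) ^ 2 * Real.exp (-(Real.log n) ^ 2) * ((D1 X).ncard : ℝ))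
    (hI : ((R.inSet i ω).ncard : ℝ) ≤ 1200 * (n : ℝ) / Real.log n) :
    (({x | probK X x ≤ (k n : ℝ) / n * (1 / (4000 * Real.log (Real.log n) ^ 3))} :
      Set (Fin n)).ncard : ℝ) ≤ (R.outSet i ω).ncard + 4 * (n / Real.log (Real.log n)) := by
  classical
  have hpos := hn.cast_pos
  have hlg := hn.log_pos
  have hll := hn.loglog
  have hπ := hn.piIn_pos
  have hπo := hn.piOut_pos
  have hρ := hn.rhoIn_nonneg
  have hmul := hn.mul_le_log
  have hle := hn.log_le
  set 𝒟 : Finset (Omega n) := (D1 X).toFinset with h𝒟def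
  have h𝒟 : ∀ D, D ∈ 𝒟 ↔ D ∈ D1 X := fun D => Set.mem_toFinset
  have hcard : (D1 X).ncard = 𝒟.card := Set.ncard_eq_toFinset_card' _
  have hne : 𝒟.Nonempty := ⟨ω.1, (h𝒟 _).2 ⟨ω.2, hω⟩⟩
  have hN : (0 : ℝ) < 𝒟.card := by exact_mod_cast hne.card_pos
  have hEDcard : ((𝒟.filter fun D => D ∈ ED n).card : ℝ) ≤
      (n : ℝ) ^ 2 * Real.exp (-(Real.log n) ^ 2) * 𝒟.card := by
    rw [hcard] at hED
    have h1 : (𝒟.filter fun D => D ∈ ED n).card = (ED n ∩ D1 X).ncard := by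
      rw [← Set.ncard_coe_finset]
      congr 1; ext D; simp [h𝒟, and_comm]
    rw [h1]
    exact hED.le
  set I := R.inSet i ω
  set a : Fin n → Omega n → ℝ := fun x D => (PiToK D.1 x).ncard with ha
  set b : Fin n → Omega n → ℝ := fun x D => (PiToK D.1 x ∩ I).ncard with hb
  set c : Fin n → Omega n → ℝ := fun x D => (PiFromV D.1 x).ncard with hc
  set Bad : Set (Fin n) := {x | Cyclic (underlying ω.1.1) (2 * ell n + 2) x} with hBad
  set S₁ : Set (Fin n) := {x | 1 / 16 * (𝒟.card : ℝ) <
    ∑ D ∈ 𝒟, (if a x D ≤ piOut n then (1 : ℝ) else 0)} with hS₁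
  set S₂ : Set (Fin n) := {x | piOut n / 16 * (𝒟.card : ℝ) < ∑ D ∈ 𝒟, b x D} with hS₂
  set S₃ : Set (Fin n) := {x | piOut n / 48 * (𝒟.card : ℝ) <
    ∑ D ∈ 𝒟, (if piIn n ≤ c x D then c x D else 0)} with hS₃
  have hprob : ∀ x, probK X x = ((𝒟.filter fun D => x ∈ K D.1).card : ℝ) / 𝒟.card := by
    intro x
    unfold probK
    rw [hcard]
    congr 2
    rw [← Set.ncard_coe_finset]
    congr 1; ext D; simp [h𝒟]
  have hunder : ∀ D ∈ 𝒟, underlying D.1 = underlying ω.1.1 := fun D hD =>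
    underlying_eq_of_mem_D1 hX hω ((h𝒟 D).1 hD)
  -- A vertex of low probability is in O, near a short cycle, or exceptional for one of the three
  -- averages. Otherwise, if checked, it is in I and so in K for every D; if unchecked, the
  -- switching inequality applies.
  have hsub : {x | probK X x ≤ (k n : ℝ) / n * (1 / (4000 * Real.log (Real.log n) ^ 3))} ⊆
      R.outSet i ω ∪ (Bad ∪ S₁ ∪ (S₂ ∪ S₃)) := by
    intro x hx
    rw [Set.mem_ofPred_eq, hn.threshold_eq] at hx
    by_contra hcon
    simp only [Set.mem_union, not_or] at hcon
    obtain ⟨hxO, ⟨hxB, hx1⟩, hx2, hx3⟩ := hcon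
    have hlow : piOut n / (4 * piIn n) < ((𝒟.filter fun D => x ∈ K D.1).card : ℝ) / 𝒟.card := by
      by_cases hxC : x ∈ R.checked i ω
      · have hxI := mem_inSet_of_checked hxC hxO
        rw [Finset.filter_true_of_mem fun D hD => inSet_subset_K hX hω ((h𝒟 D).1 hD) hxI,
          div_self hN.ne', div_lt_one (by linarith)]
        linarith [hn.piOut_le]
      · refine lt_frequency_of_switching hne (fun D : Omega n => x ∈ K D.1) (a x) (b x) (c x)
          (fun D => Nat.cast_nonneg _) (fun D => Nat.cast_nonneg _) hπo hn.piOut_le ?_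
          (not_lt.1 hx1) (not_lt.1 hx2) (not_lt.1 hx3) (fun D => Nat.cast_nonneg _)
        have h1 := sum_PiToK_le hn.ell_pos (fun D hD => by rw [hunder D hD]; exact hxB)
          (switchClosed_D1 hX hω hxC h𝒟)
        have h2 : ∑ D ∈ 𝒟 with x ∉ K D.1, (a x D - b x D) ≤
            ((∑ D ∈ 𝒟 with x ∉ K D.1, (PiToK D.1 x \ I).ncard : ℕ) : ℝ) := by
          push_cast
          refine Finset.sum_le_sum fun D _ => ?_
          have : (PiToK D.1 x ∩ I).ncard + (PiToK D.1 x \ I).ncard = (PiToK D.1 x).ncard :=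
            Set.ncard_inter_add_ncard_sdiff_eq_ncard _ _
          simp only [ha, hb]
          rw [← this]
          push_cast
          linarith
        refine h2.trans ?_
        simp only [hc]
        exact_mod_cast h1
    rw [← hprob x] at hlow
    exact absurd hx (not_le.2 hlow)
  have hn1 : (1 : ℝ) ≤ n := by linarith
  have hnn : (n : ℝ) ≤ (n : ℝ) ^ 2 := by nlinarith
  have hex := hn.exceptional_mul_le
  have hcards : ∀ F : Fin n → ℝ, (∀ x, F x ≤ n) → ∑ x, F x ≤ (n : ℝ) ^ 2 := by
    intro F hF
    have := Finset.sum_le_card_nsmul Finset.univ F n fun x _ => hF x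
    simpa [pow_two] using this
  have b0 : (Bad.ncard : ℝ) ≤ n / Real.log (Real.log n) :=
    hn.ncard_cyclic_le hG (underlying_le_currentGraph R i ω)
  have b1 : (S₁.ncard : ℝ) ≤ n / Real.log (Real.log n) :=
    hn.le_of_markov_out ((markov_card_le hne (fun D => D ∈ ED n)
      (fun x D => if a x D ≤ piOut n then (1 : ℝ) else 0) (A := n / Real.log n ^ 100)
      (B := (n : ℝ) ^ 2) (θ := 1 / 16) (fun x D => by positivity) (by positivity) (by positivity)
      (fun D _ hD => ncard_small_out_le hD)
      (fun D _ _ => hcards _ fun x => by split_ifs <;> linarith) hEDcard).trans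
      (add_le_add le_rfl hex))
  have hlarge0 : 0 ≤ 10 * (n : ℝ) / Real.log n ^ 100 * rhoIn n := by positivity
  have b2 : (S₂.ncard : ℝ) ≤ n / Real.log (Real.log n) :=
    hn.le_of_markov_inter (Nat.cast_nonneg _) hI ((markov_card_le hne (fun D => D ∈ ED n) b
      (A := I.ncard * piIn n + 10 * (n : ℝ) / Real.log n ^ 100 * rhoIn n)
      (B := (n : ℝ) ^ 2) (θ := piOut n / 16) (fun x D => Nat.cast_nonneg _) (by positivity)
      (by positivity) (fun D _ hD => sum_inter_le hD hρ hπ.le I)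
      (fun D _ _ => hcards _ fun x => ncard_le _) hEDcard).trans (add_le_add le_rfl hex))
  have b3 : (S₃.ncard : ℝ) ≤ n / Real.log (Real.log n) :=
    hn.le_of_markov_in (Nat.cast_nonneg _) ((markov_card_le hne (fun D => D ∈ ED n)
      (fun x D => if piIn n ≤ c x D then c x D else 0)
      (A := 10 * (n : ℝ) / Real.log n ^ 100 * rhoIn n)
      (B := (n : ℝ) ^ 2) (θ := piOut n / 48)
      (fun x D => by split_ifs; exacts [Nat.cast_nonneg _, le_rfl]) hlarge0
      (by positivity) (fun D _ hD => sum_large_in_le hD hρ)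
      (fun D _ _ => hcards _ fun x => by
        split_ifs
        · exact ncard_le _
        · exact hpos.le) hEDcard).trans (add_le_add le_rfl hex))
  have u1 := Set.ncard_le_ncard hsub
  have u2 := Set.ncard_union_le (R.outSet i ω) (Bad ∪ S₁ ∪ (S₂ ∪ S₃))
  have u3 := Set.ncard_union_le (Bad ∪ S₁) (S₂ ∪ S₃)
  have u4 := Set.ncard_union_le Bad S₁
  have u5 := Set.ncard_union_le S₂ S₃
  have u6 : ({x | probK X x ≤ (k n : ℝ) / n * (1 / (4000 * Real.log (Real.log n) ^ 3))} :
      Set (Fin n)).ncard ≤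
        (R.outSet i ω).ncard + (Bad.ncard + S₁.ncard + (S₂.ncard + S₃.ncard)) := by omega
  have u7 : (({x | probK X x ≤ (k n : ℝ) / n * (1 / (4000 * Real.log (Real.log n) ^ 3))} :
      Set (Fin n)).ncard : ℝ) ≤
        (R.outSet i ω).ncard + (Bad.ncard + S₁.ncard + (S₂.ncard + S₃.ncard)) := by
    exact_mod_cast u6
  linarith

end ThreeOut

theorem lemma5 (f : ℕ → ℝ) (hf : f =o[atTop] (fun n : ℕ => (n : ℝ))) :
    ∃ g : ℕ → ℝ, g =o[atTop] (fun n : ℕ => (n : ℝ)) ∧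
      ∀ (n : ℕ) (R : ThreeOut.Rule n) (i : ℕ), ∀ X ∈ (R.filtration i).classes, ∀ ω ∈ X,
        R.currentGraph i ω ∉ ThreeOut.EG n →
        ((ThreeOut.ED n ∩ ThreeOut.D1 X).ncard : ℝ) <
          (n : ℝ) ^ 2 * Real.exp (-(Real.log n) ^ 2) * ((ThreeOut.D1 X).ncard : ℝ) →
        ((R.inSet i ω).ncard : ℝ) ≤ 1200 * (n : ℝ) / Real.log n →
        ((R.outSet i ω).ncard : ℝ) ≤ f n →
        (({x | ThreeOut.probK X x ≤
            (ThreeOut.k n : ℝ) / n * (1 / (4000 * Real.log (Real.log n) ^ 3))} :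
              Set (Fin n)).ncard : ℝ) ≤ g n := by
  classical
  -- The four terms n / log log n come from the vertices near short cycles and the three Markov
  -- bounds. When `Large n` fails, the trivial bound n suffices, and this does not affect the
  -- asymptotics.
  refine ⟨fun n => f n + if ThreeOut.Large n then 4 * (n / Real.log (Real.log n)) else n,
    hf.add ?_, ?_⟩
  · have h1 : Tendsto (fun n : ℕ => 4 / Real.log (Real.log n)) atTop (nhds 0) :=
      Tendsto.div_atTop tendsto_const_nhds (Real.tendsto_log_atTop.comp
        (Real.tendsto_log_atTop.comp tendsto_natCast_atTop_atTop))
    have h2 : (fun n : ℕ => 4 / Real.log (Real.log n) * (n : ℝ)) =o[atTop]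
        (fun n : ℕ => (1 : ℝ) * (n : ℝ)) :=
      ((isLittleO_one_iff ℝ).2 h1).mul_isBigO (isBigO_refl _ _)
    simp only [one_mul] at h2
    refine h2.congr' ?_ EventuallyEq.rfl
    filter_upwards [ThreeOut.eventually_large] with n hn
    rw [if_pos hn]
    ring
  · intro n R i X hX ω hω hG hED hI hO
    by_cases hn : ThreeOut.Large n
    · simp only [if_pos hn]
      linarith [ThreeOut.ncard_low_probK_le hn hX hω hG hED hI]
    · simp only [if_neg hn]
      have h1 := ThreeOut.ncard_le {x | ThreeOut.probK X x ≤
        (ThreeOut.k n : ℝ) / n * (1 / (4000 * Real.log (Real.log n) ^ 3))}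
      have h2 : (0 : ℝ) ≤ ((R.outSet i ω).ncard : ℝ) := Nat.cast_nonneg _
      linarith
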